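/- Let $b,c\in C[0,1]$, $\lambda,a_1,a_2,a_3,a_4\in C([0,1]^2)$ be non-negative and let $\phi\in C[0,1]$. For each $N\ge 1$ let $\{X_t^N\}_{t\ge0}$ be the $N$-urn linear system, that is, the continuous-time Markov process with state space $[0,+\infty)^N$ and generator $$\mathcal L_Nf(x)=\sum_{i=1}^N b\left(\tfrac iN\right)\left(f(x^{i,+})-f(x)\right)+\frac1N\sum_{i=1}^N\sum_{j\ne i}\lambda\left(\tfrac iN,\tfrac jN\right)\left(f(x^{(i,j)})-f(x)\right),$$ where $x^{i,+}$ is obtained from $x$ by replacing $x(i)$ with $c(\frac iN)x(i)$, and $x^{(i,j)}$ is obtained from $x$ by replacing $x(i)$ with $a_1(\frac iN,\frac jN)x(i)+a_2(\frac iN,\frac jN)x(j)$ and $x(j)$ with $a_3(\frac iN,\frac jN)x(i)+a_4(\frac iN,\frac jN)x(j)$. Assume that $X_0^N(1),\dots,X_0^N(N)$ are independent and $P(X_0^N(i)=1)=\phi(\frac iN)=1-P(X_0^N(i)=0)$ for $1\le i\le N$. Let $\{\rho(t,\cdot)\}_{t\ge0}$ be the unique solution of the $C[0,1]$-valued ordinary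 differential equation (with respect to $\|\cdot\|_\infty$) $$\begin{aligned}\frac{d}{dt}\rho(t,u)={}&b(u)(c(u)-1)\rho(t,u)+\rho(t,u)\int_0^1\lambda(v,u)(a_4(v,u)-1)\,dv+\rho(t,u)\int_0^1\lambda(u,v)(a_1(u,v)-1)\,dv\\&+\int_0^1\lambda(u,v)a_2(u,v)\rho(t,v)\,dv+\int_0^1\lambda(v,u)a_3(v,u)\rho(t,v)\,dv,\qquad \rho(0,\cdot)=\phi.\end{aligned}$$ Define the pair empirical measure $\omega_t^N=\frac1{N^2}\sum_{i=1}^N\sum_{j=1}^N X_t^N(i)X_t^N(j)\,\delta_{(i/N,\,j/N)}$ on $[0,1]^2$, and write $H_t=H(t,\cdot,\cdot)$. **Lemma.** For every $T>0$ and every $H\in C([0,T]\times[0,1]\times[0,1])$, $$\lim_{N\to+\infty}\ \sup_{0\le t\le T}\ \mathbb E\left[\left(\omega_t^N(H_t)-\int_0^1\int_0^1\rho(t,u)\rho(t,v)H_t(u,v)\,du\,dv\right)^2\right]=0 .$$ -/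

import Mathlib

open MeasureTheory Filter Topology
open scoped NNReal ENNReal unitInterval

noncomputable section

namespace UrnSystem

/-- The coefficient functions of the family of `N`-urn linear systems: non-negative continuous
functions on `[0,1]` and on `[0,1]²`. -/
structure Coeffs where
  (b c : C(I, ℝ≥0))
  (lam a₁ a₂ a₃ a₄ : C(I × I, ℝ≥0))

/-- The position `i / N ∈ [0,1]` of the `i`-th urn. The urns `1, …, N` are labelled by `Fin N`,
so that `i : Fin N` stands for the urn with number `i + 1`. -/
def site {N : ℕ} (i : Fin N) : I :=
  ⟨((i : ℕ) + 1 : ℝ) / N, by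
    have h : ((i : ℕ) + 1 : ℝ) ≤ N := by exact_mod_cast i.isLt
    exact ⟨by positivity, div_le_one_of_le₀ h (Nat.cast_nonneg N)⟩⟩

variable (p : Coeffs)

/-- The configuration `x^{i,+}`: the `i`-th coordinate is multiplied by `c(i/N)`. -/
def singleJump {N : ℕ} (i : Fin N) (x : Fin N → ℝ≥0) : Fin N → ℝ≥0 :=
  Function.update x i (p.c (site i) * x i)

/-- The configuration `x^{(i,j)}` (used only for `i ≠ j`). -/
def pairJump {N : ℕ} (i j : Fin N) (x : Fin N → ℝ≥0) : Fin N → ℝ≥0 := fun k =>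
  if k = i then p.a₁ (site i, site j) * x i + p.a₂ (site i, site j) * x j
  else if k = j then p.a₃ (site i, site j) * x i + p.a₄ (site i, site j) * x j
  else x k

/-- The generator of the `N`-urn linear system, which encodes its transition rates. -/
def generator (N : ℕ) (f : (Fin N → ℝ≥0) → ℝ) : (Fin N → ℝ≥0) → ℝ := fun x =>
  (∑ i : Fin N, (p.b (site i) : ℝ) * (f (singleJump p i x) - f x)) +
    (1 / (N : ℝ)) * ∑ i : Fin N, ∑ j ∈ Finset.univ.erase i,
      (p.lam (site i, site j) : ℝ) * (f (pairJump p i j x) - f x)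

/-- The Markov semigroup `S(t) f = e^{t L} f = ∑ₖ tᵏ/k! Lᵏ f` with generator `L`. The total jump
rate out of a configuration does not depend on the configuration, so `L` is bounded in the
supremum norm and the series converges absolutely, uniformly in `x`, for every bounded `f`. -/
def semigroup (N : ℕ) (t : ℝ≥0) (f : (Fin N → ℝ≥0) → ℝ) : (Fin N → ℝ≥0) → ℝ := fun x =>
  ∑' k : ℕ, ((t : ℝ) ^ k / (k.factorial : ℝ)) * ((generator p N)^[k] f) x

/-- The σ-algebra generated by the process up to time `s`. -/
abbrev history {Ω S : Type*} [MeasurableSpace S] (X : ℝ≥0 → Ω → S) (s : ℝ≥0) : MeasurableSpace Ω :=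
  ⨆ r : Set.Iic s, MeasurableSpace.comap (X r) inferInstance

/-- `X` is an `N`-urn linear system under `P`: a Markov process with state space `[0,∞)^N`, with
respect to its own history, whose transition semigroup is the one with the above generator. -/
structure IsUrnLinearSystem (N : ℕ) {Ω : Type*} [MeasurableSpace Ω] (P : Measure Ω)
    (X : ℝ≥0 → Ω → (Fin N → ℝ≥0)) : Prop where
  measurable : ∀ t, Measurable (X t)
  markov : ∀ (s t : ℝ≥0) (f : (Fin N → ℝ≥0) → ℝ), Measurable f → (∃ C : ℝ, ∀ x, |f x| ≤ C) →
    P[fun ω => f (X (s + t) ω) | history X s] =ᵐ[P] fun ω => semigroup p N t f (X s ω)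

/-- The initial assumption: the coordinates of `x₀` are independent, and the `i`-th one is `1`
with probability `φ(i/N)` and `0` with probability `1 - φ(i/N)`. -/
structure InitialAssumption (φ : C(I, ℝ)) (N : ℕ) {Ω : Type*} [MeasurableSpace Ω] (P : Measure Ω)
    (x₀ : Ω → (Fin N → ℝ≥0)) : Prop where
  indep : ProbabilityTheory.iIndepFun (fun (i : Fin N) (ω : Ω) => x₀ ω i) P
  prob_one : ∀ i, P.real {ω | x₀ ω i = 1} = φ (site i)
  prob_zero : ∀ i, P.real {ω | x₀ ω i = 0} = 1 - φ (site i)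

theorem continuous_integral_right {F : I → I → ℝ} (hF : Continuous (Function.uncurry F)) :
    Continuous fun u => ∫ v : I, F u v := by
  simpa using continuous_parametric_integral_of_continuous (μ := (volume : Measure I)) hF
    isCompact_univ

/-- The linear operator on `C[0,1]` that drives the hydrodynamic equation for the density. -/
def densityOp (f : C(I, ℝ)) : C(I, ℝ) where
  toFun u :=
    (p.b u : ℝ) * ((p.c u : ℝ) - 1) * f u
      + f u * (∫ v : I, (p.lam (v, u) : ℝ) * ((p.a₄ (v, u) : ℝ) - 1))
      + f u * (∫ v : I, (p.lam (u, v) : ℝ) * ((p.a₁ (u, v) : ℝ) - 1))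
      + (∫ v : I, (p.lam (u, v) : ℝ) * (p.a₂ (u, v) : ℝ) * f v)
      + (∫ v : I, (p.lam (v, u) : ℝ) * (p.a₃ (v, u) : ℝ) * f v)
  continuous_toFun := by
    have h₁ := continuous_integral_right
      (F := fun u v => (p.lam (v, u) : ℝ) * ((p.a₄ (v, u) : ℝ) - 1)) (by fun_prop)
    have h₂ := continuous_integral_right
      (F := fun u v => (p.lam (u, v) : ℝ) * ((p.a₁ (u, v) : ℝ) - 1)) (by fun_prop)
    have h₃ := continuous_integral_right
      (F := fun u v => (p.lam (u, v) : ℝ) * (p.a₂ (u, v) : ℝ) * f v) (by fun_prop)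
    have h₄ := continuous_integral_right
      (F := fun u v => (p.lam (v, u) : ℝ) * (p.a₃ (v, u) : ℝ) * f v) (by fun_prop)
    fun_prop

/-- `ρ` solves the `C[0,1]`-valued linear differential equation `dρ/dt = densityOp ρ` for `t ≥ 0`,
`ρ(0) = φ`, in the supremum norm (one-sided derivative at `t = 0`; values at `t < 0` are
irrelevant). -/
structure IsHydrodynamicDensity (φ : C(I, ℝ)) (ρ : ℝ → C(I, ℝ)) : Prop where
  initial : ρ 0 = φ
  deriv : ∀ t : ℝ, 0 ≤ t → HasDerivWithinAt ρ (densityOp p (ρ t)) (Set.Ici 0) t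

/-- The pair empirical measure `N⁻² ∑ᵢ ∑ⱼ x(i) x(j) δ_{(i/N, j/N)}` of a configuration `x`. -/
def pairEmpirical {N : ℕ} (x : Fin N → ℝ≥0) : Measure (I × I) :=
  ((N : ℝ≥0) ^ 2)⁻¹ • ∑ i : Fin N, ∑ j : Fin N, (x i * x j) • Measure.dirac (site i, site j)

end UrnSystem

end

/-! ### Exponential series, and growth of the iterates of the generator. -/

namespace UrnSystem

/-! The proof is propagation of chaos for correlations `E ∏_{k ∈ s} X_t(k)` over sets `s` of at most
four distinct urns. Such a monomial has degree one in each coordinate and the jumps are linear. A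
pair jump with one urn in `s` and one outside therefore yields monomials of the same degree, and
these jumps together with the single jumps give a closed linear operator `corrOp`
(`generator_monomial`). A pair jump with both urns in `s` breaks this closure. There are boundedly
many such pairs, each with rate of order `1/N`, so their effect is `O(1/N)` once fourth moments are
bounded uniformly in `N` (`fourth_moment`, a Lyapunov argument).

The products `∏_{k ∈ s} ρ(t, k/N)` solve the same equation up to a Riemann-sum error, and by
independence they have the same initial value. On sets of a fixed size `corrOp` is bounded in
supremum norm uniformly in `N`, so Grönwall's inequality gives uniform convergence of the
correlations (`eventually_abs_correlation_sub_le`).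

The error of the pair empirical measure is a weighted average of `X(i)X(j) - ρρ` plus a
deterministic double Riemann-sum error. The second moment of the average is a sum over quadruples of
urns. For four distinct urns, correlations of orders 2 and 4 nearly factorise; the at most `6N³`
other quadruples out of `N⁴` are controlled by fourth moments (`integral_sq_sum_pairFluct_le`).

The Markov property is available for bounded functions only, while monomials are unbounded.
Kolmogorov's forward equation is therefore proved first for bounded functions, from the exponential
series, and then extended by truncation to functions dominated by a weight that jumps increase by at
most a constant factor. -/

theorem summable_expSeries {a : ℕ → ℝ} {K R : ℝ} (ha : ∀ k, |a k| ≤ K * R ^ k) (t : ℝ) :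
    Summable fun k : ℕ => t ^ k / (k.factorial : ℝ) * a k := by
  refine Summable.of_norm_bounded
    (g := fun k : ℕ => K * ((|t| * R) ^ k / (k.factorial : ℝ)))
    ((Real.summable_pow_div_factorial _).mul_left K) fun k => ?_
  rw [norm_mul, norm_div, norm_pow, Real.norm_eq_abs, Real.norm_eq_abs, Real.norm_eq_abs,
    abs_of_nonneg (a := (k.factorial : ℝ)) (Nat.cast_nonneg _)]
  calc |t| ^ k / (k.factorial : ℝ) * |a k| ≤ |t| ^ k / (k.factorial : ℝ) * (K * R ^ k) :=
        mul_le_mul_of_nonneg_left (ha k) (by positivity)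
    _ = _ := by rw [mul_pow]; ring

/-- The exponential series `∑ₖ tᵏ/k! aₖ` may be differentiated termwise if `a` grows at most
geometrically. -/
theorem hasDerivAt_expSeries {a : ℕ → ℝ} {K R : ℝ} (ha : ∀ k, |a k| ≤ K * R ^ k) (t : ℝ) :
    HasDerivAt (fun s : ℝ => ∑' k : ℕ, s ^ k / (k.factorial : ℝ) * a k)
      (∑' k : ℕ, t ^ k / (k.factorial : ℝ) * a (k + 1)) t := by
  have ha' : ∀ k, |a (k + 1)| ≤ (K * R) * R ^ k := fun k =>
    (ha (k + 1)).trans_eq (by ring)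
  have hterm : ∀ (n : ℕ) (y : ℝ),
      ((n + 1 : ℕ) : ℝ) * y ^ n / ((n + 1).factorial : ℝ) * a (n + 1)
        = y ^ n / (n.factorial : ℝ) * a (n + 1) := by
    intro n y
    have h1 : (n.factorial : ℝ) ≠ 0 := by positivity
    have h2 : ((n + 1 : ℕ) : ℝ) ≠ 0 := by positivity
    rw [Nat.factorial_succ]
    push_cast at h2 ⊢
    field_simp
  -- The radius exceeds `|t|`, so `t` is interior to a ball on which every termwise derivative is
  -- dominated by its absolute value at `ρ`.
  set ρ := |t| + 1
  have hρ : 0 ≤ ρ := by positivity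
  -- The truncated exponent at `n = 0` is harmless because of the factor `n`.
  set g' : ℕ → ℝ → ℝ := fun n y => (n : ℝ) * y ^ (n - 1) / (n.factorial : ℝ) * a n
  have hg'1 : ∀ n y, g' (n + 1) y = y ^ n / (n.factorial : ℝ) * a (n + 1) := fun n y => by
    simpa [g'] using hterm n y
  have hg'0 : ∀ y, g' 0 y = 0 := fun y => by simp [g']
  have key : HasDerivAt (fun s : ℝ => ∑' k : ℕ, s ^ k / (k.factorial : ℝ) * a k)
      (∑' k : ℕ, g' k t) t := by
    refine hasDerivAt_tsum_of_isPreconnected (t := Metric.ball (0 : ℝ) ρ)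
      (u := fun n => |g' n ρ|) (y₀ := 0) ?_ Metric.isOpen_ball
      (convex_ball (0 : ℝ) ρ).isPreconnected (fun n y _ => ?_) (fun n y hy => ?_)
      (by simp [ρ]; positivity) (summable_expSeries ha 0) (by simp [ρ])
    · rw [← summable_nat_add_iff 1]
      simp_rw [hg'1]
      exact (summable_expSeries ha' ρ).abs
    · exact ((hasDerivAt_pow n y).div_const _).mul_const _
    · have hy' : |y| ≤ ρ := by simpa using (Metric.mem_ball.1 hy).le
      rcases n with _ | n
      · simp [hg'0]
      · rw [hg'1, hg'1, norm_mul, abs_mul, norm_div, abs_div, norm_pow, abs_pow,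
          Real.norm_eq_abs, Real.norm_eq_abs, Real.norm_eq_abs, abs_of_nonneg hρ]
        gcongr
  have h0 : (∑' k : ℕ, g' k t) = ∑' k : ℕ, t ^ k / (k.factorial : ℝ) * a (k + 1) := by
    rw [Summable.tsum_eq_zero_add]
    · simp_rw [hg'0, hg'1, zero_add]
    · rw [← summable_nat_add_iff 1]
      simp_rw [hg'1]
      exact summable_expSeries ha' t
  rwa [h0] at key

variable (p : Coeffs)

/-- The total jump rate of the `N`-urn system. -/
noncomputable def totalRate (N : ℕ) : ℝ :=
  (∑ i : Fin N, (p.b (site i) : ℝ)) +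
    (1 / (N : ℝ)) * ∑ i : Fin N, ∑ j ∈ Finset.univ.erase i, (p.lam (site i, site j) : ℝ)

theorem totalRate_nonneg (N : ℕ) : 0 ≤ totalRate p N := by
  unfold totalRate; positivity

/-- If every jump changes `f` by a value in `[-B, B]`, then `|L f| ≤ totalRate * B`. -/
theorem abs_generator_le_of_jump {N : ℕ} {f : (Fin N → ℝ≥0) → ℝ} {x : Fin N → ℝ≥0} {B : ℝ}
    (hs : ∀ i, |f (singleJump p i x) - f x| ≤ B) (hp : ∀ i j, |f (pairJump p i j x) - f x| ≤ B) :
    |generator p N f x| ≤ totalRate p N * B := by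
  unfold generator totalRate
  rw [add_mul, Finset.sum_mul, mul_assoc, Finset.sum_mul]
  refine (abs_add_le _ _).trans (add_le_add ?_ ?_)
  · refine (Finset.abs_sum_le_sum_abs _ _).trans (Finset.sum_le_sum fun i _ => ?_)
    rw [abs_mul, NNReal.abs_eq]
    exact mul_le_mul_of_nonneg_left (hs i) (NNReal.coe_nonneg _)
  · rw [abs_mul, abs_of_nonneg (by positivity : (0 : ℝ) ≤ 1 / (N : ℝ))]
    refine mul_le_mul_of_nonneg_left ?_ (by positivity)
    refine (Finset.abs_sum_le_sum_abs _ _).trans (Finset.sum_le_sum fun i _ => ?_)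
    rw [Finset.sum_mul]
    refine (Finset.abs_sum_le_sum_abs _ _).trans (Finset.sum_le_sum fun j _ => ?_)
    rw [abs_mul, NNReal.abs_eq]
    exact mul_le_mul_of_nonneg_left (hp i j) (NNReal.coe_nonneg _)

/-- A measurable weight `W ≥ 1` that a jump increases at most by the factor `D`. -/
structure IsJumpWeight {N : ℕ} (W : (Fin N → ℝ≥0) → ℝ) (D : ℝ) : Prop where
  measurable : Measurable W
  one_le : ∀ x, 1 ≤ W x
  single : ∀ i x, W (singleJump p i x) ≤ D * W x
  pair : ∀ i j x, W (pairJump p i j x) ≤ D * W x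

variable {p}

/-- With this weight the weighted estimates become the estimates for bounded functions. -/
theorem isJumpWeight_one {N : ℕ} : IsJumpWeight p (N := N) (fun _ => 1) 1 :=
  ⟨measurable_const, fun _ => le_rfl, fun _ _ => by simp, fun _ _ _ => by simp⟩

theorem IsJumpWeight.abs_generator_le {N : ℕ} {W : (Fin N → ℝ≥0) → ℝ} {D K : ℝ}
    (hW : IsJumpWeight p W D) {f : (Fin N → ℝ≥0) → ℝ} (hK : 0 ≤ K) (hf : ∀ x, |f x| ≤ K * W x)
    (x : Fin N → ℝ≥0) :
    |generator p N f x| ≤ K * (totalRate p N * (D + 1)) * W x := by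
  have h : ∀ y, W y ≤ D * W x → |f y - f x| ≤ K * (D + 1) * W x := fun y hy =>
    calc |f y - f x| ≤ |f y| + |f x| := abs_sub _ _
      _ ≤ K * W y + K * W x := add_le_add (hf y) (hf x)
      _ ≤ K * (D * W x) + K * W x := by gcongr
      _ = _ := by ring
  exact (abs_generator_le_of_jump p (fun i => h _ (hW.single i x))
    (fun i j => h _ (hW.pair i j x))).trans_eq (by ring)

/-- If there is an urn, `1 ≤ W` after a jump forces `D ≥ 0`; if `N = 0`, the sign of `D` is unknown
but the total rate vanishes. -/
theorem IsJumpWeight.rate_nonneg {N : ℕ} {W : (Fin N → ℝ≥0) → ℝ} {D : ℝ}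
    (hW : IsJumpWeight p W D) : 0 ≤ totalRate p N * (D + 1) := by
  by_cases hN : Nonempty (Fin N)
  · obtain ⟨i⟩ := hN
    have h1 := hW.one_le 0
    have h2 := hW.single i 0
    have h3 := hW.one_le (singleJump p i 0)
    have : 0 ≤ D := by
      by_contra h
      nlinarith
    exact mul_nonneg (totalRate_nonneg p N) (by linarith)
  · have : IsEmpty (Fin N) := not_nonempty_iff.1 hN
    simp [totalRate]

theorem IsJumpWeight.abs_iterate_generator_le {N : ℕ} {W : (Fin N → ℝ≥0) → ℝ} {D K : ℝ}
    (hW : IsJumpWeight p W D) {f : (Fin N → ℝ≥0) → ℝ} (hK : 0 ≤ K) (hf : ∀ x, |f x| ≤ K * W x)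
    (k : ℕ) (x : Fin N → ℝ≥0) :
    |(generator p N)^[k] f x| ≤ K * (totalRate p N * (D + 1)) ^ k * W x := by
  induction k generalizing x with
  | zero => simpa using hf x
  | succ k ih =>
    rw [Function.iterate_succ_apply']
    refine (hW.abs_generator_le (mul_nonneg hK (pow_nonneg hW.rate_nonneg k)) ih x).trans_eq ?_
    ring

variable (p)

theorem measurable_singleJump {N : ℕ} (i : Fin N) : Measurable (singleJump p i) := by
  unfold singleJump
  refine measurable_pi_iff.2 fun k => ?_
  by_cases h : k = i
  · subst h
    simp only [Function.update_self]
    fun_prop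
  · simp only [Function.update_of_ne h]
    fun_prop

theorem measurable_pairJump {N : ℕ} (i j : Fin N) : Measurable (pairJump p i j) := by
  refine measurable_pi_iff.2 fun k => ?_
  unfold pairJump
  split_ifs <;> fun_prop

theorem measurable_generator {N : ℕ} {f : (Fin N → ℝ≥0) → ℝ} (hf : Measurable f) :
    Measurable (generator p N f) := by
  unfold generator
  have h1 := fun i : Fin N => hf.comp (measurable_singleJump p i)
  have h2 := fun i j : Fin N => hf.comp (measurable_pairJump p i j)
  exact (Finset.measurable_sum _ fun i _ => ((h1 i).sub hf).const_mul _).add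
    (Measurable.const_mul (Finset.measurable_sum _ fun i _ => Finset.measurable_sum _ fun j _ =>
      ((h2 i j).sub hf).const_mul _) _)

theorem measurable_iterate_generator {N : ℕ} {f : (Fin N → ℝ≥0) → ℝ} (hf : Measurable f)
    (k : ℕ) : Measurable ((generator p N)^[k] f) := by
  induction k with
  | zero => exact hf
  | succ k ih =>
    rw [Function.iterate_succ_apply']
    exact measurable_generator p ih

theorem tendsto_generator {N : ℕ} {f : ℕ → (Fin N → ℝ≥0) → ℝ} {g : (Fin N → ℝ≥0) → ℝ}
    (h : ∀ x, Tendsto (fun n => f n x) atTop (𝓝 (g x))) (x : Fin N → ℝ≥0) :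
    Tendsto (fun n => generator p N (f n) x) atTop (𝓝 (generator p N g x)) := by
  unfold generator
  refine Tendsto.add (tendsto_finsetSum _ fun i _ => ((h _).sub (h _)).const_mul _)
    (Tendsto.const_mul _ (tendsto_finsetSum _ fun i _ => tendsto_finsetSum _ fun j _ =>
      ((h _).sub (h _)).const_mul _))

theorem tendsto_iterate_generator {N : ℕ} {f : ℕ → (Fin N → ℝ≥0) → ℝ}
    {g : (Fin N → ℝ≥0) → ℝ} (h : ∀ x, Tendsto (fun n => f n x) atTop (𝓝 (g x))) (k : ℕ)
    (x : Fin N → ℝ≥0) :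
    Tendsto (fun n => (generator p N)^[k] (f n) x) atTop (𝓝 ((generator p N)^[k] g x)) := by
  induction k generalizing x with
  | zero => exact h x
  | succ k ih =>
    simp only [Function.iterate_succ_apply']
    exact tendsto_generator p ih x

/-- Truncation at a non-negative level preserves `L V ≤ C V`. -/
theorem generator_min_le {N : ℕ} {V : (Fin N → ℝ≥0) → ℝ} {C M : ℝ} (hC : 0 ≤ C) (hM : 0 ≤ M)
    (hV : ∀ x, generator p N V x ≤ C * V x) (x : Fin N → ℝ≥0) :
    generator p N (fun y => min (V y) M) x ≤ C * min (V x) M := by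
  -- Below the level, truncation keeps the value at `x` and can only lower the values after a jump.
  -- Above it, the truncated function is at its maximum, so all increments are nonpositive.
  by_cases h : V x ≤ M
  · rw [min_eq_left h]
    refine le_trans ?_ (hV x)
    unfold generator
    simp only [min_eq_left h]
    gcongr
    · exact min_le_left _ _
    · exact min_le_left _ _
  · rw [min_eq_right (not_le.1 h).le]
    refine le_trans ?_ (mul_nonneg hC hM)
    unfold generator
    simp only [min_eq_right (not_le.1 h).le]
    have h1 : ∀ y, min (V y) M - M ≤ 0 := fun y => sub_nonpos.2 (min_le_right _ _)
    refine add_nonpos (Finset.sum_nonpos fun i _ => ?_)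
      (mul_nonpos_of_nonneg_of_nonpos (by positivity)
        (Finset.sum_nonpos fun i _ => Finset.sum_nonpos fun j _ => ?_))
    · exact mul_nonpos_of_nonneg_of_nonpos (NNReal.coe_nonneg _) (h1 _)
    · exact mul_nonpos_of_nonneg_of_nonpos (NNReal.coe_nonneg _) (h1 _)

end UrnSystem

/-! ### Forward equation and Lyapunov bounds. -/

namespace UrnSystem
variable {p : Coeffs} {N : ℕ} {Ω : Type*} [MeasurableSpace Ω] {P : Measure Ω}
  {X : ℝ≥0 → Ω → (Fin N → ℝ≥0)}

theorem integrable_comp_of_bounded [IsFiniteMeasure P] {f : (Fin N → ℝ≥0) → ℝ} (hf : Measurable f) {K : ℝ}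
    (hK : ∀ x, |f x| ≤ K) {Y : Ω → (Fin N → ℝ≥0)} (hY : Measurable Y) :
    Integrable (fun ω => f (Y ω)) P :=
  Integrable.of_bound (hf.comp hY).aestronglyMeasurable K (ae_of_all _ fun _ => hK _)

theorem integrable_comp_of_le {f W : (Fin N → ℝ≥0) → ℝ} (hf : Measurable f) {K : ℝ}
    (hK : ∀ x, |f x| ≤ K * W x) {Y : Ω → (Fin N → ℝ≥0)} (hY : Measurable Y)
    (hW : Integrable (fun ω => W (Y ω)) P) : Integrable (fun ω => f (Y ω)) P :=
  (hW.const_mul K).mono' (hf.comp hY).aestronglyMeasurable (ae_of_all _ fun _ => hK _)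

theorem abs_integral_comp_le {f W : (Fin N → ℝ≥0) → ℝ} {K : ℝ}
    (hK : ∀ x, |f x| ≤ K * W x) {Y : Ω → (Fin N → ℝ≥0)}
    (hW : Integrable (fun ω => W (Y ω)) P) :
    |∫ ω, f (Y ω) ∂P| ≤ K * ∫ ω, W (Y ω) ∂P := by
  rw [← integral_const_mul]
  exact norm_integral_le_of_norm_le (f := fun ω => f (Y ω)) (hW.const_mul K)
    (ae_of_all _ fun _ => hK _)

/-- The Markov property at time `0`, integrated, for bounded functions. -/
theorem IsUrnLinearSystem.integral_eq_tsum_of_bounded [IsProbabilityMeasure P]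
    (hX : IsUrnLinearSystem p N P X)
    {f : (Fin N → ℝ≥0) → ℝ} (hf : Measurable f) {K : ℝ} (hK : ∀ x, |f x| ≤ K) (t : ℝ≥0) :
    ∫ ω, f (X t ω) ∂P = ∑' k : ℕ, (t : ℝ) ^ k / (k.factorial : ℝ) *
      ∫ ω, (generator p N)^[k] f (X 0 ω) ∂P := by
  have hm : history X 0 ≤ ‹MeasurableSpace Ω› :=
    iSup_le fun r => (hX.measurable r).comap_le
  have hK0 : 0 ≤ K := (abs_nonneg _).trans (hK 0)
  have h1 := hX.markov 0 t f hf ⟨K, hK⟩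
  rw [zero_add] at h1
  rw [← integral_condExp hm, integral_congr_ae h1]
  have hb := fun k => isJumpWeight_one.abs_iterate_generator_le (p := p) hK0
    (f := f) (by simpa using hK) k
  set R := totalRate p N * (1 + 1)
  have hint : ∀ k, Integrable (fun ω => (generator p N)^[k] f (X 0 ω)) P := fun k =>
    integrable_comp_of_le (measurable_iterate_generator p hf k) (hb k) (hX.measurable 0)
      (integrable_const _)
  unfold semigroup
  -- Expectation and series may be interchanged because the iterates are bounded by `K * R ^ k`.
  rw [← integral_tsum_of_summable_integral_norm]
  · simp_rw [integral_const_mul]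
  · exact fun k => (hint k).const_mul _
  · refine Summable.of_nonneg_of_le (fun k => integral_nonneg fun ω => norm_nonneg _) (fun k => ?_)
      (summable_expSeries (a := fun k => K * R ^ k) (K := K) (R := R) (fun k => ?_) (t : ℝ))
    · refine (integral_mono_of_nonneg (ae_of_all _ fun ω => norm_nonneg _) (integrable_const
        ((t : ℝ) ^ k / (k.factorial : ℝ) * (K * R ^ k))) (ae_of_all _ fun ω => ?_)).trans_eq
        (by simp)
      simp only [norm_mul]
      rw [Real.norm_of_nonneg (by positivity)]
      exact mul_le_mul_of_nonneg_left ((hb k _).trans_eq (mul_one _)) (by positivity)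
    · rw [abs_of_nonneg (mul_nonneg hK0 (pow_nonneg (isJumpWeight_one.rate_nonneg) k))]

/-- Differentiating an exponential series shifts its coefficients by one, and here the shift is one
application of the generator. The bounded and the weighted case share this step. -/
theorem IsUrnLinearSystem.hasDerivWithinAt_of_tsum {f : (Fin N → ℝ≥0) → ℝ} {K R : ℝ}
    (hb : ∀ k, |∫ ω, (generator p N)^[k] f (X 0 ω) ∂P| ≤ K * R ^ k)
    (h₀ : ∀ t : ℝ≥0, ∫ ω, f (X t ω) ∂P = ∑' k : ℕ, (t : ℝ) ^ k / (k.factorial : ℝ) *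
      ∫ ω, (generator p N)^[k] f (X 0 ω) ∂P)
    (h₁ : ∀ t : ℝ≥0, ∫ ω, generator p N f (X t ω) ∂P = ∑' k : ℕ, (t : ℝ) ^ k / (k.factorial : ℝ) *
      ∫ ω, (generator p N)^[k] (generator p N f) (X 0 ω) ∂P) {t : ℝ} (ht : 0 ≤ t) :
    HasDerivWithinAt (fun s : ℝ => ∫ ω, f (X s.toNNReal ω) ∂P)
      (∫ ω, generator p N f (X t.toNNReal ω) ∂P) (Set.Ici 0) t := by
  rw [h₁]
  simp only [← Function.iterate_succ_apply]
  rw [Real.coe_toNNReal t ht]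
  refine (hasDerivAt_expSeries hb t).hasDerivWithinAt.congr (fun s hs => ?_) ?_
  · rw [h₀, Real.coe_toNNReal s hs]
  · rw [h₀, Real.coe_toNNReal t ht]

/-- The expectation of a bounded function is differentiable in time, and the derivative is the
expectation of its image under the generator. -/
theorem IsUrnLinearSystem.hasDerivWithinAt_of_bounded [IsProbabilityMeasure P]
    (hX : IsUrnLinearSystem p N P X)
    {f : (Fin N → ℝ≥0) → ℝ} (hf : Measurable f) {K : ℝ} (hK : ∀ x, |f x| ≤ K)
    {t : ℝ} (ht : 0 ≤ t) :
    HasDerivWithinAt (fun s : ℝ => ∫ ω, f (X s.toNNReal ω) ∂P)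
      (∫ ω, generator p N f (X t.toNNReal ω) ∂P) (Set.Ici 0) t := by
  have hK0 : 0 ≤ K := (abs_nonneg _).trans (hK 0)
  have hb := fun k => isJumpWeight_one.abs_iterate_generator_le (p := p) hK0
    (f := f) (by simpa using hK) k
  refine IsUrnLinearSystem.hasDerivWithinAt_of_tsum (K := K) (R := totalRate p N * (1 + 1))
    (fun k => ?_) (fun t => hX.integral_eq_tsum_of_bounded hf hK t)
    (fun t => hX.integral_eq_tsum_of_bounded (measurable_generator p hf)
      (fun x => (hb 1 x).trans_eq (mul_one _)) t) ht
  · exact (abs_integral_comp_le (hb k) (integrable_const _)).trans_eq (by simp)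

/-- The function `e^{-Ct} g(t)` is antitone; no sign of `g` or `C` is needed. -/
theorem le_exp_mul_of_hasDerivWithinAt {g g' : ℝ → ℝ} {C : ℝ}
    (hg : ∀ t, 0 ≤ t → HasDerivWithinAt g (g' t) (Set.Ici 0) t) (h : ∀ t, 0 ≤ t → g' t ≤ C * g t)
    {t : ℝ} (ht : 0 ≤ t) : g t ≤ Real.exp (C * t) * g 0 := by
  have hd : ∀ s, 0 ≤ s → HasDerivWithinAt (fun s => Real.exp (-(C * s)) * g s)
      (Real.exp (-(C * s)) * (-(C * 1)) * g s + Real.exp (-(C * s)) * g' s) (Set.Ici 0) s :=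
    fun s hs => ((((hasDerivAt_id s).const_mul C).neg.exp).hasDerivWithinAt).mul (hg s hs)
  have hanti : AntitoneOn (fun s => Real.exp (-(C * s)) * g s) (Set.Ici 0) := by
    refine antitoneOn_of_hasDerivWithinAt_nonpos (f' := fun s =>
      Real.exp (-(C * s)) * (-(C * 1)) * g s + Real.exp (-(C * s)) * g' s) (convex_Ici 0)
      (fun s hs => (hd s hs).continuousWithinAt) (fun s hs => ?_) (fun s hs => ?_)
    · exact (hd s (interior_subset hs)).mono interior_subset
    · have := h s (interior_subset hs)
      have h2 := Real.exp_pos (-(C * s))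
      nlinarith [mul_le_mul_of_nonneg_left this h2.le]
  have := hanti (Set.mem_Ici.2 le_rfl) (Set.mem_Ici.2 ht) ht
  simp only [mul_zero, neg_zero, Real.exp_zero, one_mul] at this
  calc g t = Real.exp (C * t) * (Real.exp (-(C * t)) * g t) := by
        rw [← mul_assoc, ← Real.exp_add]; simp
    _ ≤ _ := mul_le_mul_of_nonneg_left this (Real.exp_pos _).le

/-- A Lyapunov function `V`, with `L V ≤ C V`, has expectation at most `e^{Ct} E V(X₀)`. -/
theorem IsUrnLinearSystem.lyapunov [IsProbabilityMeasure P]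
    (hX : IsUrnLinearSystem p N P X)
    {V : (Fin N → ℝ≥0) → ℝ} (hV : Measurable V) (hV0 : ∀ x, 0 ≤ V x) {C : ℝ} (hC : 0 ≤ C)
    (hLV : ∀ x, generator p N V x ≤ C * V x) (h0 : Integrable (fun ω => V (X 0 ω)) P) (t : ℝ≥0) :
    Integrable (fun ω => V (X t ω)) P ∧
      ∫ ω, V (X t ω) ∂P ≤ Real.exp (C * t) * ∫ ω, V (X 0 ω) ∂P := by
  set B := Real.exp (C * t) * ∫ ω, V (X 0 ω) ∂P
  have hB : 0 ≤ B := mul_nonneg (Real.exp_pos _).le (integral_nonneg fun ω => hV0 _)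
  have hmeas : ∀ M : ℝ, Measurable fun x => min (V x) M := fun M => hV.min measurable_const
  have hbd : ∀ M : ℝ, 0 ≤ M → ∀ x, |min (V x) M| ≤ M := fun M hM x => by
    rw [abs_of_nonneg (le_min (hV0 x) hM)]
    exact min_le_right _ _
  -- The truncation is bounded, so the forward equation applies to it, and by `generator_min_le` it
  -- is still a Lyapunov function with the same `C`. The bound does not depend on `M`.
  have htr : ∀ M : ℝ, 0 ≤ M → ∫ ω, min (V (X t ω)) M ∂P ≤ B := by
    intro M hM
    have hi : ∀ s : ℝ≥0, Integrable (fun ω => min (V (X s ω)) M) P := fun s =>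
      integrable_comp_of_bounded (hmeas M) (hbd M hM) (hX.measurable s)
    have h1 := le_exp_mul_of_hasDerivWithinAt (C := C)
      (fun s hs => hX.hasDerivWithinAt_of_bounded (hmeas M) (hbd M hM) (t := s) hs)
      (fun s _ => by
        rw [← integral_const_mul]
        refine integral_mono ?_ ((hi _).const_mul C) fun ω => generator_min_le p hC hM hLV _
        exact integrable_comp_of_bounded (measurable_generator p (hmeas M))
          (fun x => (isJumpWeight_one.abs_generator_le hM (by simpa using hbd M hM) x).trans_eq
            (mul_one _)) (hX.measurable _)) t.2
    simp only [Real.toNNReal_zero] at h1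
    rw [show Real.toNNReal (t : ℝ≥0).1 = t from Real.toNNReal_coe] at h1
    refine h1.trans (mul_le_mul_of_nonneg_left ?_ (Real.exp_pos _).le)
    exact integral_mono (hi 0) h0 fun ω => min_le_left _ _
  -- Monotone convergence in `M` yields integrability and the bound at once.
  have hlint : ∫⁻ ω, ENNReal.ofReal (V (X t ω)) ∂P ≤ ENNReal.ofReal B := by
    have hsup : ∀ ω, ENNReal.ofReal (V (X t ω))
        = ⨆ M : ℕ, ENNReal.ofReal (min (V (X t ω)) M) := by
      intro ω
      refine le_antisymm ?_ (iSup_le fun M => ENNReal.ofReal_le_ofReal (min_le_left _ _))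
      obtain ⟨M, hM⟩ := exists_nat_ge (V (X t ω))
      exact le_iSup_of_le M (by rw [min_eq_left hM])
    simp_rw [hsup]
    rw [lintegral_iSup]
    · refine iSup_le fun M => ?_
      rw [← ofReal_integral_eq_lintegral_ofReal]
      · exact ENNReal.ofReal_le_ofReal (htr M (Nat.cast_nonneg M))
      · exact integrable_comp_of_bounded (hmeas M) (hbd M (Nat.cast_nonneg M)) (hX.measurable t)
      · exact ae_of_all _ fun ω => le_min (hV0 _) (Nat.cast_nonneg M)
    · exact fun M => ((hmeas M).comp (hX.measurable t)).ennreal_ofReal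
    · exact fun M M' h ω => ENNReal.ofReal_le_ofReal
        (min_le_min_left _ (Nat.cast_le.2 h))
  have hVt : Measurable fun ω => V (X t ω) := hV.comp (hX.measurable t)
  refine ⟨⟨hVt.aestronglyMeasurable, ?_⟩, ?_⟩
  · rw [hasFiniteIntegral_iff_ofReal (ae_of_all _ fun ω => hV0 _)]
    exact hlint.trans_lt ENNReal.ofReal_lt_top
  · rw [integral_eq_lintegral_of_nonneg_ae (ae_of_all _ fun ω => hV0 _) hVt.aestronglyMeasurable]
    exact ENNReal.toReal_le_of_le_ofReal hB hlint

/-- A jump weight is its own Lyapunov function. The constant may depend on `N`, since only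
integrability is kept. -/
theorem IsUrnLinearSystem.integrable_weight [IsProbabilityMeasure P]
    (hX : IsUrnLinearSystem p N P X)
    {W : (Fin N → ℝ≥0) → ℝ} {D : ℝ} (hW : IsJumpWeight p W D)
    (h0 : Integrable (fun ω => W (X 0 ω)) P) (t : ℝ≥0) : Integrable (fun ω => W (X t ω)) P := by
  have hpos : ∀ x, 0 ≤ W x := fun x => zero_le_one.trans (hW.one_le x)
  refine (hX.lyapunov hW.measurable hpos hW.rate_nonneg (fun x => ?_) h0 t).1
  refine (le_abs_self _).trans ((hW.abs_generator_le zero_le_one (f := W)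
    (fun y => ?_) x).trans_eq (by rw [one_mul]))
  rw [one_mul, abs_of_nonneg (hpos y)]

/-- The bounded case is applied to the truncations of `f` to `[-M, M]`. Dominated convergence, with
`W` as majorant, passes to the limit in the expectation at time `t`, in each coefficient, and in the
series. -/
theorem IsUrnLinearSystem.integral_eq_tsum [IsProbabilityMeasure P]
    (hX : IsUrnLinearSystem p N P X)
    {W : (Fin N → ℝ≥0) → ℝ} {D : ℝ} (hW : IsJumpWeight p W D)
    (h0 : Integrable (fun ω => W (X 0 ω)) P)
    {f : (Fin N → ℝ≥0) → ℝ} (hf : Measurable f) {K : ℝ} (hK0 : 0 ≤ K) (hK : ∀ x, |f x| ≤ K * W x)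
    (t : ℝ≥0) :
    ∫ ω, f (X t ω) ∂P = ∑' k : ℕ, (t : ℝ) ^ k / (k.factorial : ℝ) *
      ∫ ω, (generator p N)^[k] f (X 0 ω) ∂P := by
  set F : ℕ → (Fin N → ℝ≥0) → ℝ := fun M x => max (-(M : ℝ)) (min (f x) M)
  have hFm : ∀ M, Measurable (F M) := fun M =>
    measurable_const.max (hf.min measurable_const)
  have hFM : ∀ M x, |F M x| ≤ M := fun M x => by
    have hM : (0 : ℝ) ≤ M := Nat.cast_nonneg M
    exact abs_le.2 ⟨le_max_left _ _, max_le (by linarith) (min_le_right _ _)⟩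
  have hFf : ∀ M x, |F M x| ≤ |f x| := fun M x => by
    have hM : (0 : ℝ) ≤ M := Nat.cast_nonneg M
    refine abs_le.2 ⟨le_max_of_le_right (le_min (neg_abs_le _) ?_), max_le ?_ ?_⟩
    · linarith [abs_nonneg (f x)]
    · linarith [abs_nonneg (f x)]
    · exact (min_le_left _ _).trans (le_abs_self _)
  have hFt : ∀ x, Tendsto (fun M => F M x) atTop (𝓝 (f x)) := fun x => by
    obtain ⟨M₀, hM₀⟩ := exists_nat_ge |f x|
    refine tendsto_const_nhds.congr' ?_
    filter_upwards [eventually_ge_atTop M₀] with M hM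
    have : |f x| ≤ M := hM₀.trans (Nat.cast_le.2 hM)
    rw [abs_le] at this
    simp only [F]
    rw [min_eq_left this.2, max_eq_right this.1]
  have hFW : ∀ M x, |F M x| ≤ K * W x := fun M x => (hFf M x).trans (hK x)
  have hb := fun M => hW.abs_iterate_generator_le hK0 (hFW M)
  set R := totalRate p N * (D + 1)
  have hR : 0 ≤ R := hW.rate_nonneg
  have hlhs : Tendsto (fun M => ∫ ω, F M (X t ω) ∂P) atTop (𝓝 (∫ ω, f (X t ω) ∂P)) :=
    tendsto_integral_of_dominated_convergence (fun ω => K * W (X t ω))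
      (fun M => ((hFm M).comp (hX.measurable t)).aestronglyMeasurable)
      ((hX.integrable_weight hW h0 t).const_mul K)
      (fun M => ae_of_all _ fun ω => hFW M _) (ae_of_all _ fun ω => hFt _)
  have hk : ∀ k, Tendsto (fun M => ∫ ω, (generator p N)^[k] (F M) (X 0 ω) ∂P) atTop
      (𝓝 (∫ ω, (generator p N)^[k] f (X 0 ω) ∂P)) := fun k =>
    tendsto_integral_of_dominated_convergence (fun ω => K * R ^ k * W (X 0 ω))
      (fun M => ((measurable_iterate_generator p (hFm M) k).comp
        (hX.measurable 0)).aestronglyMeasurable)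
      (h0.const_mul _) (fun M => ae_of_all _ fun ω => hb M k _)
      (ae_of_all _ fun ω => tendsto_iterate_generator p hFt k _)
  set E := ∫ ω, W (X 0 ω) ∂P
  have hrhs := tendsto_tsum_of_dominated_convergence
    (f := fun M k => (t : ℝ) ^ k / (k.factorial : ℝ) *
      ∫ ω, (generator p N)^[k] (F M) (X 0 ω) ∂P)
    (bound := fun k => (t : ℝ) ^ k / (k.factorial : ℝ) * ((K * E) * R ^ k)) (𝓕 := atTop)
    (summable_expSeries (K := |K * E|) (R := R) (fun k => by
      rw [abs_mul, abs_of_nonneg (pow_nonneg hR k)]) _)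
    (fun k => (hk k).const_mul _)
    (Eventually.of_forall fun M k => by
      rw [norm_mul, Real.norm_of_nonneg (by positivity)]
      refine mul_le_mul_of_nonneg_left ?_ (by positivity)
      exact (abs_integral_comp_le (hb M k) h0).trans_eq (by ring))
  refine tendsto_nhds_unique hlhs (hrhs.congr fun M => ?_)
  exact (hX.integral_eq_tsum_of_bounded (hFm M) (hFM M) t).symm

/-- Kolmogorov's forward equation for functions dominated by a jump weight. -/
theorem IsUrnLinearSystem.hasDerivWithinAt [IsProbabilityMeasure P]
    (hX : IsUrnLinearSystem p N P X)
    {W : (Fin N → ℝ≥0) → ℝ} {D : ℝ} (hW : IsJumpWeight p W D)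
    (h0 : Integrable (fun ω => W (X 0 ω)) P)
    {f : (Fin N → ℝ≥0) → ℝ} (hf : Measurable f) {K : ℝ} (hK0 : 0 ≤ K) (hK : ∀ x, |f x| ≤ K * W x)
    {t : ℝ} (ht : 0 ≤ t) :
    HasDerivWithinAt (fun s : ℝ => ∫ ω, f (X s.toNNReal ω) ∂P)
      (∫ ω, generator p N f (X t.toNNReal ω) ∂P) (Set.Ici 0) t := by
  refine IsUrnLinearSystem.hasDerivWithinAt_of_tsum (K := K * ∫ ω, W (X 0 ω) ∂P)
    (R := totalRate p N * (D + 1)) (fun k => ?_)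
    (fun t => hX.integral_eq_tsum hW h0 hf hK0 hK t)
    (fun t => hX.integral_eq_tsum hW h0 (measurable_generator p hf)
      (mul_nonneg hK0 hW.rate_nonneg) (hW.abs_generator_le hK0 hK) t) ht
  exact (abs_integral_comp_le (hW.abs_iterate_generator_le hK0 hK k) h0).trans_eq (by ring)

end UrnSystem

/-! ### Riemann sums. -/

namespace UrnSystem

/-- Error bound for right-endpoint Riemann sums on `[0,1]` in terms of the oscillation at scale
`1 / N`. -/
theorem abs_riemannSum_sub_integral_le {f : I → ℝ} (hf : Continuous f) {N : ℕ} (hN : 0 < N)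
    {ε : ℝ} (h : ∀ u v : I, dist u v ≤ 1 / N → |f u - f v| ≤ ε) :
    |(1 / (N : ℝ)) * ∑ i : Fin N, f (site i) - ∫ v : I, f v| ≤ ε := by
  have hN' : (0 : ℝ) < N := Nat.cast_pos.2 hN
  -- Extending `f` to the real line by its endpoint values allows the integral to be split over the
  -- `N` cells; each site is the right endpoint of its cell.
  set g : ℝ → ℝ := fun x => f (Set.projIcc 0 1 zero_le_one x) with hg
  have hgc : Continuous g := hf.comp continuous_projIcc
  have h1 : ∫ v : I, f v = ∫ x in (0 : ℝ)..1, g x := by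
    rw [intervalIntegral.integral_of_le zero_le_one, ← integral_Icc_eq_integral_Ioc,
      ← integral_subtype_comap measurableSet_Icc, unitInterval.volume_def]
    exact integral_congr_ae (ae_of_all _ fun v => by simp [hg])
  have h2 : ∫ x in (0 : ℝ)..1, g x
      = ∑ i ∈ Finset.range N, ∫ x in ((i : ℕ) / N : ℝ)..((i + 1 : ℕ) / N : ℝ), g x := by
    rw [intervalIntegral.sum_integral_adjacent_intervals (a := fun i : ℕ => (i / N : ℝ))
      (fun k _ => hgc.intervalIntegrable _ _)]
    simp [hN'.ne']
  have h3 : ∀ i : Fin N, ∫ x in ((i : ℕ) / N : ℝ)..(((i : ℕ) + 1 : ℕ) / N : ℝ), f (site i)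
      = (1 / (N : ℝ)) * f (site i) := fun i => by
    rw [intervalIntegral.integral_const, smul_eq_mul]
    push_cast
    ring
  rw [h1, h2, Finset.sum_range, Finset.mul_sum, ← Finset.sum_sub_distrib]
  refine (Finset.abs_sum_le_sum_abs _ _).trans ?_
  have h4 : ∀ i : Fin N, |1 / (N : ℝ) * f (site i)
      - ∫ x in ((i : ℕ) / N : ℝ)..(((i : ℕ) + 1 : ℕ) / N : ℝ), g x| ≤ ε * (1 / N) := by
    intro i
    rw [← h3 i, ← intervalIntegral.integral_sub (by simp) (hgc.intervalIntegrable _ _)]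
    have hle : ((i : ℕ) / N : ℝ) ≤ (((i : ℕ) + 1 : ℕ) / N : ℝ) := by gcongr; simp
    rw [← Real.norm_eq_abs]
    refine (intervalIntegral.norm_integral_le_of_norm_le_const (E := ℝ) (C := ε)
      fun x hx => ?_).trans_eq ?_
    · rw [Set.uIoc_of_le hle] at hx
      refine h _ _ ?_
      have hx0 : 0 ≤ x := le_trans (by positivity) hx.1.le
      have hx1 : x ≤ 1 := hx.2.trans (by
        have := (site i).2.2
        simp only [site] at this
        exact_mod_cast this)
      rw [Set.projIcc_of_mem zero_le_one ⟨hx0, hx1⟩, Subtype.dist_eq, Real.dist_eq]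
      simp only [site]
      have e1 := hx.1
      have e2 := hx.2
      push_cast at e2
      have e3 : (((i : ℕ) : ℝ) + 1) / N = (i : ℕ) / N + 1 / N := by ring
      rw [abs_le]
      constructor <;> linarith
    · rw [abs_of_nonneg (sub_nonneg.2 hle)]
      push_cast
      ring
  refine (Finset.sum_le_sum fun i _ => h4 i).trans_eq ?_
  rw [Finset.sum_const, Finset.card_univ, Fintype.card_fin, nsmul_eq_mul]
  field_simp

/-- Riemann sums converge uniformly in a compact parameter. -/
theorem eventually_riemannSum {Y : Type*} [PseudoMetricSpace Y] [CompactSpace Y]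
    {F : Y → I → ℝ} (hF : Continuous (Function.uncurry F)) {ε : ℝ} (hε : 0 < ε) :
    ∀ᶠ N : ℕ in atTop, ∀ y : Y,
      |(1 / (N : ℝ)) * ∑ i : Fin N, F y (site i) - ∫ v : I, F y v| ≤ ε := by
  -- Uniform continuity on the compact product gives one modulus for all parameters.
  obtain ⟨δ, hδ, h⟩ := Metric.uniformContinuous_iff.1
    (CompactSpace.uniformContinuous_of_continuous hF) ε hε
  have hlim := (tendsto_one_div_atTop_nhds_zero_nat (𝕜 := ℝ)).eventually (gt_mem_nhds hδ)
  filter_upwards [hlim, eventually_gt_atTop 0] with N hN hN0 y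
  refine abs_riemannSum_sub_integral_le (hF.comp (by fun_prop : Continuous fun v => (y, v))) hN0
    fun u v huv => ?_
  have := h (a := (y, u)) (b := (y, v)) (by
    simpa [Prod.dist_eq] using huv.trans_lt hN)
  exact this.le

end UrnSystem

/-! ### Bounds on coefficients and jumps, initial law, and uniform fourth moments. -/

namespace UrnSystem

/-- A common bound `K ≥ 1` for all coefficient functions. -/
structure Coeffs.IsBound (p : Coeffs) (K : ℝ) : Prop where
  one_le : 1 ≤ K
  b : ∀ u, (p.b u : ℝ) ≤ K
  c : ∀ u, (p.c u : ℝ) ≤ K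
  lam : ∀ z, (p.lam z : ℝ) ≤ K
  a₁ : ∀ z, (p.a₁ z : ℝ) ≤ K
  a₂ : ∀ z, (p.a₂ z : ℝ) ≤ K
  a₃ : ∀ z, (p.a₃ z : ℝ) ≤ K
  a₄ : ∀ z, (p.a₄ z : ℝ) ≤ K

theorem Coeffs.exists_isBound (p : Coeffs) : ∃ K, p.IsBound K := by
  have h1 : ∀ {Y : Type} [TopologicalSpace Y] [CompactSpace Y] (f : C(Y, ℝ≥0)),
      ∃ K : ℝ, ∀ y, (f y : ℝ) ≤ K := fun f => by
    obtain ⟨K, hK⟩ := (isCompact_range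
      (NNReal.continuous_coe.comp f.continuous)).bddAbove
    exact ⟨K, fun y => hK ⟨y, rfl⟩⟩
  obtain ⟨K1, h1'⟩ := h1 p.b
  obtain ⟨K2, h2'⟩ := h1 p.c
  obtain ⟨K3, h3'⟩ := h1 p.lam
  obtain ⟨K4, h4'⟩ := h1 p.a₁
  obtain ⟨K5, h5'⟩ := h1 p.a₂
  obtain ⟨K6, h6'⟩ := h1 p.a₃
  obtain ⟨K7, h7'⟩ := h1 p.a₄
  have hle : ∀ i : Fin 7, (![K1, K2, K3, K4, K5, K6, K7] i)
      ≤ 1 + ∑ j, |![K1, K2, K3, K4, K5, K6, K7] j| := fun i => by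
    have := Finset.single_le_sum (f := fun j => |![K1, K2, K3, K4, K5, K6, K7] j|)
      (fun j _ => abs_nonneg _) (Finset.mem_univ i)
    have h2 := le_abs_self (![K1, K2, K3, K4, K5, K6, K7] i)
    linarith
  refine ⟨1 + ∑ j, |![K1, K2, K3, K4, K5, K6, K7] j|,
    le_add_of_nonneg_right (Finset.sum_nonneg fun j _ => abs_nonneg _),
    fun u => (h1' u).trans (hle 0), fun u => (h2' u).trans (hle 1), fun u => (h3' u).trans (hle 2),
    fun u => (h4' u).trans (hle 3), fun u => (h5' u).trans (hle 4), fun u => (h6' u).trans (hle 5),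
    fun u => (h7' u).trans (hle 6)⟩

section Linearity
variable (p : Coeffs) {N : ℕ}

theorem generator_add (f g : (Fin N → ℝ≥0) → ℝ) (x : Fin N → ℝ≥0) :
    generator p N (fun y => f y + g y) x = generator p N f x + generator p N g x := by
  unfold generator
  have h : ∀ r a b c d : ℝ, r * (a + b - (c + d)) = r * (a - c) + r * (b - d) :=
    fun r a b c d => by ring
  simp only [h, Finset.sum_add_distrib]
  ring

theorem generator_const_mul (a : ℝ) (f : (Fin N → ℝ≥0) → ℝ) (x : Fin N → ℝ≥0) :
    generator p N (fun y => a * f y) x = a * generator p N f x := by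
  unfold generator
  have h : ∀ r c d : ℝ, r * (a * c - a * d) = a * (r * (c - d)) := fun r c d => by ring
  simp only [h, ← Finset.mul_sum]
  ring

theorem generator_sum {ι : Type*} (s : Finset ι) (f : ι → (Fin N → ℝ≥0) → ℝ) (x : Fin N → ℝ≥0) :
    generator p N (fun y => ∑ i ∈ s, f i y) x = ∑ i ∈ s, generator p N (f i) x := by
  classical
  induction s using Finset.induction_on with
  | empty => simp [generator]
  | insert i s hi ih => simp only [Finset.sum_insert hi, generator_add, ih]

end Linearity

/-- Ordered pairs are sorted by how many of their members lie in `s`; a pair with exactly one member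
in `s` is counted in both orientations. -/
theorem sum_erase_decomp {ι : Type*} [Fintype ι] [DecidableEq ι] (s : Finset ι) (T : ι → ι → ℝ)
    (hT : ∀ i j, i ∉ s → j ∉ s → T i j = 0) :
    ∑ i, ∑ j ∈ Finset.univ.erase i, T i j
      = ∑ i ∈ s, ∑ j ∈ sᶜ, (T i j + T j i) + ∑ i ∈ s, ∑ j ∈ s.erase i, T i j := by
  have h1 : ∀ i ∈ s, ∑ j ∈ Finset.univ.erase i, T i j
      = ∑ j ∈ sᶜ, T i j + ∑ j ∈ s.erase i, T i j := fun i hi => by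
    rw [← Finset.sum_union]
    · congr 1
      ext j
      simp only [Finset.mem_erase, Finset.mem_univ, and_true, Finset.mem_union, Finset.mem_compl]
      grind
    · exact Finset.disjoint_left.2 fun j h h' =>
        (Finset.mem_compl.1 h) (Finset.mem_of_mem_erase h')
  have h2 : ∀ i ∈ sᶜ, ∑ j ∈ Finset.univ.erase i, T i j = ∑ j ∈ s, T i j := fun i hi => by
    have hi' := Finset.mem_compl.1 hi
    refine (Finset.sum_subset (fun j hj => ?_) fun j _ hj => hT i j hi' hj).symm
    simp only [Finset.mem_erase, Finset.mem_univ, and_true]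
    rintro rfl
    exact hi' hj
  rw [← Finset.sum_add_sum_compl s, Finset.sum_congr rfl h1, Finset.sum_congr rfl h2,
    Finset.sum_comm (s := sᶜ)]
  simp only [Finset.sum_add_distrib]
  ring

/-- The generator applied to a function that depends only on the coordinates in `s`. -/
theorem generator_of_dependsOn (p : Coeffs) {N : ℕ} {f : (Fin N → ℝ≥0) → ℝ} (s : Finset (Fin N))
    (hf : ∀ x y, (∀ k ∈ s, x k = y k) → f x = f y) (x : Fin N → ℝ≥0) :
    generator p N f x
      = ∑ i ∈ s, (p.b (site i) : ℝ) * (f (singleJump p i x) - f x)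
        + (1 / (N : ℝ)) * (∑ i ∈ s, ∑ j ∈ sᶜ,
            ((p.lam (site i, site j) : ℝ) * (f (pairJump p i j x) - f x)
              + (p.lam (site j, site i) : ℝ) * (f (pairJump p j i x) - f x))
          + ∑ i ∈ s, ∑ j ∈ s.erase i,
            (p.lam (site i, site j) : ℝ) * (f (pairJump p i j x) - f x)) := by
  unfold generator
  rw [sum_erase_decomp s]
  · congr 1
    refine (Finset.sum_subset (Finset.subset_univ s) fun i _ hi => ?_).symm
    rw [hf (singleJump p i x) x, sub_self, mul_zero]
    intro k hk
    exact Function.update_of_ne (fun h : k = i => hi (h ▸ hk)) _ _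
  · intro i j hi hj
    rw [hf (pairJump p i j x) x, sub_self, mul_zero]
    intro k hk
    unfold pairJump
    rw [if_neg (fun h : k = i => hi (h ▸ hk)), if_neg (fun h : k = j => hj (h ▸ hk))]

section Jumps
variable (p : Coeffs) {N : ℕ} (x : Fin N → ℝ≥0)

theorem singleJump_self (i : Fin N) : singleJump p i x i = p.c (site i) * x i := by
  simp [singleJump]

theorem singleJump_of_ne {i k : Fin N} (h : k ≠ i) : singleJump p i x k = x k := by
  simp [singleJump, h]

theorem pairJump_left (i j : Fin N) : pairJump p i j x i
    = p.a₁ (site i, site j) * x i + p.a₂ (site i, site j) * x j := by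
  simp [pairJump]

theorem pairJump_right {i j : Fin N} (h : j ≠ i) : pairJump p i j x j
    = p.a₃ (site i, site j) * x i + p.a₄ (site i, site j) * x j := by
  simp [pairJump, h]

theorem pairJump_of_ne {i j k : Fin N} (h : k ≠ i) (h' : k ≠ j) : pairJump p i j x k = x k := by
  simp [pairJump, h, h']

end Jumps

variable {p : Coeffs} {K : ℝ}

theorem Coeffs.IsBound.singleJump_le (hK : p.IsBound K) {N : ℕ} (i k : Fin N) (x : Fin N → ℝ≥0) :
    (singleJump p i x k : ℝ) ≤ K * x k := by
  have hx : (0 : ℝ) ≤ x k := NNReal.coe_nonneg _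
  by_cases h : k = i
  · subst h
    rw [singleJump_self]
    push_cast
    exact mul_le_mul_of_nonneg_right (hK.c _) hx
  · rw [singleJump_of_ne p x h]
    nlinarith [hK.one_le]

theorem Coeffs.IsBound.pairJump_le (hK : p.IsBound K) {N : ℕ} (i j k : Fin N)
    (x : Fin N → ℝ≥0) (hk : k = i ∨ k = j) : (pairJump p i j x k : ℝ) ≤ K * (x i + x j) := by
  have hi : (0 : ℝ) ≤ x i := NNReal.coe_nonneg _
  have hj : (0 : ℝ) ≤ x j := NNReal.coe_nonneg _
  rw [mul_add]
  by_cases h : k = i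
  · subst h
    rw [pairJump_left]
    push_cast
    exact add_le_add (mul_le_mul_of_nonneg_right (hK.a₁ _) hi)
      (mul_le_mul_of_nonneg_right (hK.a₂ _) hj)
  · obtain rfl : k = j := hk.resolve_left h
    rw [pairJump_right p x h]
    push_cast
    exact add_le_add (mul_le_mul_of_nonneg_right (hK.a₃ _) hi)
      (mul_le_mul_of_nonneg_right (hK.a₄ _) hj)

/-- After a pair jump inside `s`, every coordinate in `s` is at most `2 K ∑ₛ x`. -/
theorem Coeffs.IsBound.pairJump_le_sum (hK : p.IsBound K) {N : ℕ} {s : Finset (Fin N)}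
    {i j k : Fin N} (hi : i ∈ s) (hj : j ∈ s) (hk : k ∈ s) (x : Fin N → ℝ≥0) :
    (pairJump p i j x k : ℝ) ≤ 2 * K * ∑ l ∈ s, (x l : ℝ) := by
  have hle : ∀ l ∈ s, (x l : ℝ) ≤ ∑ l ∈ s, (x l : ℝ) := fun l hl =>
    Finset.single_le_sum (f := fun l => (x l : ℝ)) (fun _ _ => NNReal.coe_nonneg _) hl
  have h0 : (0 : ℝ) ≤ ∑ l ∈ s, (x l : ℝ) := (NNReal.coe_nonneg _).trans (hle i hi)
  have h1 := hK.one_le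
  by_cases h : k = i ∨ k = j
  · refine (hK.pairJump_le i j k x h).trans ?_
    nlinarith [hle i hi, hle j hj]
  · rw [not_or] at h
    rw [pairJump_of_ne p x h.1 h.2]
    nlinarith [hle k hk]

/-- The fourth power of the total mass, a jump weight that dominates all monomials of degree at
most `4`. -/
noncomputable def massWeight {N : ℕ} (x : Fin N → ℝ≥0) : ℝ := (1 + ∑ k, (x k : ℝ)) ^ 4

/-- After a jump each coordinate is at most `2K` times the old total mass. The resulting factor
grows with `N`, which is harmless: the weight serves integrability and the forward equation, never
an estimate uniform in `N`. -/
theorem Coeffs.IsBound.isJumpWeight_massWeight (hK : p.IsBound K) (N : ℕ) :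
    IsJumpWeight p (massWeight (N := N)) ((1 + N * (2 * K)) ^ 4) := by
  have h1 := hK.one_le
  have key : ∀ x y : Fin N → ℝ≥0, (∀ k, (y k : ℝ) ≤ 2 * K * ∑ l, (x l : ℝ)) →
      massWeight y ≤ (1 + N * (2 * K)) ^ 4 * massWeight x := fun x y h => by
    unfold massWeight
    rw [← mul_pow]
    have h0 : 0 ≤ ∑ l, (x l : ℝ) := by positivity
    refine pow_le_pow_left₀ (by positivity) ?_ 4
    have h2 := Finset.sum_le_sum fun k (_ : k ∈ Finset.univ) => h k
    rw [Finset.sum_const, Finset.card_univ, Fintype.card_fin, nsmul_eq_mul] at h2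
    have h3 : (0 : ℝ) ≤ N * (2 * K) := by positivity
    nlinarith
  refine ⟨by unfold massWeight; fun_prop, fun x => ?_, fun i x => key _ _ fun k => ?_,
    fun i j x => key _ _ fun k => ?_⟩
  · unfold massWeight
    exact one_le_pow₀ (le_add_of_nonneg_right (by positivity))
  · refine (hK.singleJump_le i k x).trans ?_
    have h2 : (x k : ℝ) ≤ ∑ l, (x l : ℝ) := Finset.single_le_sum (f := fun l => (x l : ℝ))
      (fun _ _ => NNReal.coe_nonneg _) (Finset.mem_univ k)
    have h3 : (0 : ℝ) ≤ x k := NNReal.coe_nonneg _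
    nlinarith
  · exact hK.pairJump_le_sum (Finset.mem_univ i) (Finset.mem_univ j) (Finset.mem_univ k) x

theorem coe_le_one_add_sum {N : ℕ} (x : Fin N → ℝ≥0) (k : Fin N) :
    (x k : ℝ) ≤ 1 + ∑ l, (x l : ℝ) :=
  (Finset.single_le_sum (f := fun l => (x l : ℝ)) (fun _ _ => NNReal.coe_nonneg _)
    (Finset.mem_univ k)).trans (le_add_of_nonneg_left zero_le_one)

/-- In `K ^ 5` one factor bounds the rate and four the jump. The `17` is `1` for the single jump
plus `2 * 8` for the two orientations of a pair, by `(a + b)⁴ ≤ 8 (a⁴ + b⁴)`. -/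
theorem Coeffs.IsBound.generator_pow_four_le (hK : p.IsBound K) {N : ℕ} (k : Fin N)
    (x : Fin N → ℝ≥0) :
    generator p N (fun y => (y k : ℝ) ^ 4) x
      ≤ 17 * K ^ 5 * ((x k : ℝ) ^ 4 + (1 / (N : ℝ)) * ∑ j, (x j : ℝ) ^ 4) := by
  have h1 := hK.one_le
  have hN : (0 : ℝ) < N := Nat.cast_pos.2 (Nat.pos_of_ne_zero fun h => by subst h; exact k.elim0)
  have hK0 : 0 ≤ K := zero_le_one.trans h1
  rw [generator_of_dependsOn p {k} (fun x y h => by rw [h k (Finset.mem_singleton_self k)])]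
  simp only [Finset.sum_singleton, Finset.erase_singleton, Finset.sum_empty, add_zero]
  have hpair : ∀ i j : Fin N, k = i ∨ k = j →
      (p.lam (site i, site j) : ℝ) * ((pairJump p i j x k : ℝ) ^ 4 - (x k : ℝ) ^ 4)
        ≤ 8 * K ^ 5 * ((x i : ℝ) ^ 4 + (x j : ℝ) ^ 4) := fun i j h => by
    have h2 : (pairJump p i j x k : ℝ) ^ 4 ≤ K ^ 4 * (8 * ((x i : ℝ) ^ 4 + (x j : ℝ) ^ 4)) := by
      refine (pow_le_pow_left₀ (NNReal.coe_nonneg _) (hK.pairJump_le i j k x h) 4).trans ?_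
      rw [mul_pow]
      refine mul_le_mul_of_nonneg_left ?_ (by positivity)
      exact (add_pow_le (NNReal.coe_nonneg _) (NNReal.coe_nonneg _) 4).trans_eq (by norm_num)
    calc (p.lam (site i, site j) : ℝ) * ((pairJump p i j x k : ℝ) ^ 4 - (x k : ℝ) ^ 4)
        ≤ (p.lam (site i, site j) : ℝ) * (K ^ 4 * (8 * ((x i : ℝ) ^ 4 + (x j : ℝ) ^ 4))) :=
          mul_le_mul_of_nonneg_left (by linarith [pow_nonneg (NNReal.coe_nonneg (x k)) 4])
            (NNReal.coe_nonneg _)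
      _ ≤ K * (K ^ 4 * (8 * ((x i : ℝ) ^ 4 + (x j : ℝ) ^ 4))) :=
          mul_le_mul_of_nonneg_right (hK.lam _) (by positivity)
      _ = _ := by ring
  have hsingle : (p.b (site k) : ℝ) * ((singleJump p k x k : ℝ) ^ 4 - (x k : ℝ) ^ 4)
      ≤ K ^ 5 * (x k : ℝ) ^ 4 := by
    calc (p.b (site k) : ℝ) * ((singleJump p k x k : ℝ) ^ 4 - (x k : ℝ) ^ 4)
        ≤ (p.b (site k) : ℝ) * (K * x k) ^ 4 := by
          refine mul_le_mul_of_nonneg_left ?_ (NNReal.coe_nonneg _)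
          have := pow_le_pow_left₀ (NNReal.coe_nonneg _) (hK.singleJump_le k k x) 4
          linarith [pow_nonneg (NNReal.coe_nonneg (x k)) 4]
      _ ≤ K * (K * x k) ^ 4 := mul_le_mul_of_nonneg_right (hK.b _) (by positivity)
      _ = _ := by ring
  have hsum : ∑ j ∈ ({k} : Finset (Fin N))ᶜ,
      ((p.lam (site k, site j) : ℝ) * ((pairJump p k j x k : ℝ) ^ 4 - (x k : ℝ) ^ 4)
        + (p.lam (site j, site k) : ℝ) * ((pairJump p j k x k : ℝ) ^ 4 - (x k : ℝ) ^ 4))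
      ≤ 16 * K ^ 5 * (N * (x k : ℝ) ^ 4 + ∑ j, (x j : ℝ) ^ 4) := by
    calc _ ≤ ∑ j ∈ ({k} : Finset (Fin N))ᶜ, 16 * K ^ 5 * ((x k : ℝ) ^ 4 + (x j : ℝ) ^ 4) :=
          Finset.sum_le_sum fun j _ => by
            linarith [hpair k j (Or.inl rfl), hpair j k (Or.inr rfl)]
      _ ≤ ∑ j, 16 * K ^ 5 * ((x k : ℝ) ^ 4 + (x j : ℝ) ^ 4) :=
          Finset.sum_le_sum_of_subset_of_nonneg (Finset.subset_univ _)
            fun j _ _ => by positivity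
      _ = _ := by
          rw [← Finset.mul_sum, Finset.sum_add_distrib, Finset.sum_const, Finset.card_univ,
            Fintype.card_fin, nsmul_eq_mul]
  have h5 : (1 / (N : ℝ)) * (16 * K ^ 5 * (N * (x k : ℝ) ^ 4 + ∑ j, (x j : ℝ) ^ 4))
      = 16 * K ^ 5 * ((x k : ℝ) ^ 4 + (1 / (N : ℝ)) * ∑ j, (x j : ℝ) ^ 4) := by
    field_simp
  have h6 := mul_le_mul_of_nonneg_left hsum (by positivity : (0 : ℝ) ≤ 1 / N)
  have h7 : 0 ≤ K ^ 5 * ((1 / (N : ℝ)) * ∑ j, (x j : ℝ) ^ 4) := by positivity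
  linarith

variable {Ω : Type*} [MeasurableSpace Ω] {P : Measure Ω} [IsProbabilityMeasure P]

/-- The two disjoint events have probabilities adding up to `1`. -/
theorem InitialAssumption.ae_zero_or_one {φ : C(I, ℝ)} {N : ℕ} {x₀ : Ω → (Fin N → ℝ≥0)}
    (h : InitialAssumption φ N P x₀) (hm : Measurable x₀) :
    ∀ᵐ ω ∂P, ∀ i, x₀ ω i = 0 ∨ x₀ ω i = 1 := by
  rw [ae_all_iff]
  intro i
  have hmi : Measurable fun ω => x₀ ω i := (measurable_pi_apply i).comp hm
  have h0 : MeasurableSet {ω | x₀ ω i = 0} := hmi (measurableSet_singleton 0)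
  have h1 : MeasurableSet {ω | x₀ ω i = 1} := hmi (measurableSet_singleton 1)
  have hd : Disjoint {ω | x₀ ω i = 0} {ω | x₀ ω i = 1} :=
    Set.disjoint_left.2 fun ω ha hb => zero_ne_one (ha.symm.trans hb)
  have hu : P.real ({ω | x₀ ω i = 0} ∪ {ω | x₀ ω i = 1}) = 1 := by
    rw [measureReal_union hd h1, h.prob_zero, h.prob_one]
    ring
  have := (prob_compl_eq_zero_iff (μ := P) (h0.union h1)).2
    (by rwa [measureReal_def, ENNReal.toReal_eq_one_iff] at hu)
  exact this

/-- Each coordinate is almost surely an indicator, and independence factorises the mean. Hence the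
Grönwall argument starts from an error that is exactly zero. -/
theorem InitialAssumption.integral_prod {φ : C(I, ℝ)} {N : ℕ} {x₀ : Ω → (Fin N → ℝ≥0)}
    (h : InitialAssumption φ N P x₀) (hm : Measurable x₀) (s : Finset (Fin N)) :
    ∫ ω, ∏ k ∈ s, (x₀ ω k : ℝ) ∂P = ∏ k ∈ s, φ (site k) := by
  have hmi : ∀ i, Measurable fun ω => x₀ ω i := fun i => (measurable_pi_apply i).comp hm
  have hmean : ∀ i, ∫ ω, (x₀ ω i : ℝ) ∂P = φ (site i) := fun i => by
    have hms : MeasurableSet {ω | x₀ ω i = 1} := hmi i (measurableSet_singleton 1)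
    rw [← h.prob_one i, ← integral_indicator_one hms]
    refine integral_congr_ae ?_
    filter_upwards [h.ae_zero_or_one hm] with ω hω
    rcases hω i with h0 | h1
    · simp [h0, Set.indicator]
    · simp [h1, Set.indicator]
  have hind := (h.indep.precomp (Subtype.val_injective (p := fun i => i ∈ s))).comp
    (fun _ => fun y : ℝ≥0 => (y : ℝ)) (fun _ => NNReal.continuous_coe.measurable)
  have := hind.integral_fun_prod_eq_prod_integral fun i =>
    (NNReal.continuous_coe.measurable.comp (hmi i)).aestronglyMeasurable
  simp only [Function.comp_apply] at this
  calc ∫ ω, ∏ k ∈ s, (x₀ ω k : ℝ) ∂P = ∫ ω, ∏ k : s, (x₀ ω k : ℝ) ∂P := by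
        simp_rw [← Finset.prod_coe_sort s]
    _ = ∏ k : s, ∫ ω, (x₀ ω k : ℝ) ∂P := this
    _ = ∏ k : s, φ (site (k : Fin N)) := by simp_rw [hmean]
    _ = _ := Finset.prod_coe_sort s fun k => φ (site k)

theorem InitialAssumption.integrable_massWeight {φ : C(I, ℝ)} {N : ℕ}
    {x₀ : Ω → (Fin N → ℝ≥0)} (h : InitialAssumption φ N P x₀) (hm : Measurable x₀) :
    Integrable (fun ω => massWeight (x₀ ω)) P := by
  refine Integrable.of_bound (C := (1 + N : ℝ) ^ 4) (Measurable.aestronglyMeasurable (by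
    unfold massWeight; fun_prop)) ?_
  filter_upwards [h.ae_zero_or_one hm] with ω hω
  unfold massWeight
  rw [Real.norm_of_nonneg (by positivity)]
  refine pow_le_pow_left₀ (by positivity) ?_ 4
  have : ∑ k, (x₀ ω k : ℝ) ≤ ∑ k : Fin N, (1 : ℝ) := Finset.sum_le_sum fun k _ => by
    rcases hω k with h | h <;> simp [h]
  simpa using this

/-- Fourth moments are bounded uniformly in the number of urns. -/
theorem IsUrnLinearSystem.fourth_moment {φ : C(I, ℝ)} {N : ℕ} {X : ℝ≥0 → Ω → (Fin N → ℝ≥0)}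
    (hX : IsUrnLinearSystem p N P X) (hA : InitialAssumption φ N P (X 0)) (hK : p.IsBound K)
    (k : Fin N) (t : ℝ≥0) :
    Integrable (fun ω => (X t ω k : ℝ) ^ 4) P ∧
      ∫ ω, (X t ω k : ℝ) ^ 4 ∂P ≤ Real.exp (51 * K ^ 5 * t) * 2 := by
  have h1 := hK.one_le
  have hN : (0 : ℝ) < N := Nat.cast_pos.2 (Nat.pos_of_ne_zero fun h => by subst h; exact k.elim0)
  have hK0 : 0 ≤ K := zero_le_one.trans h1
  -- One fourth power alone does not close, because the empirical mean of all fourth powers enters.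
  -- The mean itself grows at rate at most `34 K⁵`, so adding it closes the inequality with `51 = 17
  -- + 34`. At time `0` both summands are at most `1`, whence the factor `2`.
  set V : (Fin N → ℝ≥0) → ℝ := fun x => (x k : ℝ) ^ 4 + (1 / (N : ℝ)) * ∑ j, (x j : ℝ) ^ 4
  have hVm : Measurable V := by fun_prop
  have hV0 : ∀ x, 0 ≤ V x := fun x => by positivity
  have hle : ∀ x : Fin N → ℝ≥0, (x k : ℝ) ^ 4 ≤ V x := fun x =>
    le_add_of_nonneg_right (by positivity)
  have hLV : ∀ x, generator p N V x ≤ 51 * K ^ 5 * V x := fun x => by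
    simp only [V]
    rw [generator_add, generator_const_mul, generator_sum]
    have h2 := hK.generator_pow_four_le k x
    have h3 := Finset.sum_le_sum fun j (_ : j ∈ Finset.univ) => hK.generator_pow_four_le j x
    rw [← Finset.mul_sum, Finset.sum_add_distrib, Finset.sum_const, Finset.card_univ,
      Fintype.card_fin, nsmul_eq_mul] at h3
    have h4 := mul_le_mul_of_nonneg_left h3 (by positivity : (0 : ℝ) ≤ 1 / N)
    have h5 : (1 / (N : ℝ)) * (17 * K ^ 5 * (∑ j, (x j : ℝ) ^ 4
        + N * ((1 / (N : ℝ)) * ∑ j, (x j : ℝ) ^ 4)))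
        = 34 * K ^ 5 * ((1 / (N : ℝ)) * ∑ j, (x j : ℝ) ^ 4) := by
      field_simp
      ring
    have h6 : 0 ≤ K ^ 5 * (x k : ℝ) ^ 4 := by positivity
    linarith
  have hV2 : ∀ᵐ ω ∂P, V (X 0 ω) ≤ 2 := by
    filter_upwards [hA.ae_zero_or_one (hX.measurable 0)] with ω hω
    have h2 : ∀ j, (X 0 ω j : ℝ) ^ 4 ≤ 1 := fun j => by rcases hω j with h | h <;> simp [h]
    have h3 := Finset.sum_le_sum fun j (_ : j ∈ Finset.univ) => h2 j
    rw [Finset.sum_const, Finset.card_univ, Fintype.card_fin, nsmul_eq_mul, mul_one] at h3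
    have h4 : (1 / (N : ℝ)) * ∑ j, (X 0 ω j : ℝ) ^ 4 ≤ 1 := by
      rw [one_div, inv_mul_le_iff₀ hN]
      linarith
    simp only [V]
    linarith [h2 k]
  have h0 : Integrable (fun ω => V (X 0 ω)) P :=
    Integrable.of_bound (hVm.comp (hX.measurable 0)).aestronglyMeasurable 2 (by
      filter_upwards [hV2] with ω hω
      rwa [Real.norm_of_nonneg (hV0 _)])
  obtain ⟨hi, hb⟩ := hX.lyapunov hVm hV0 (by positivity : 0 ≤ 51 * K ^ 5) hLV h0 t
  have hm : Measurable fun ω => (X t ω k : ℝ) ^ 4 := by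
    have := hX.measurable t
    fun_prop
  have hik : Integrable (fun ω => (X t ω k : ℝ) ^ 4) P :=
    hi.mono' hm.aestronglyMeasurable (ae_of_all _ fun ω => by
      rw [Real.norm_of_nonneg (by positivity)]
      exact hle _)
  refine ⟨hik, (integral_mono hik hi fun ω => hle _).trans (hb.trans ?_)⟩
  refine mul_le_mul_of_nonneg_left ?_ (Real.exp_pos _).le
  exact (integral_mono_ae h0 (integrable_const 2) hV2).trans_eq (by simp)

end UrnSystem

/-! ### The operator driving the correlations, and the generator on monomials. -/

namespace UrnSystem

section Rates
variable (p : Coeffs)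

/-- The rate at which the mass at `u` grows on its own. -/
noncomputable def siteRate (u : I) : ℝ := (p.b u : ℝ) * ((p.c u : ℝ) - 1)

/-- The rate at which the mass at `u` grows proportionally to itself because of `v`. -/
noncomputable def selfRate (u v : I) : ℝ :=
  (p.lam (v, u) : ℝ) * ((p.a₄ (v, u) : ℝ) - 1) + (p.lam (u, v) : ℝ) * ((p.a₁ (u, v) : ℝ) - 1)

/-- The rate at which the mass at `u` grows proportionally to the mass at `v`. -/
noncomputable def crossRate (u v : I) : ℝ :=
  (p.lam (u, v) : ℝ) * (p.a₂ (u, v) : ℝ) + (p.lam (v, u) : ℝ) * (p.a₃ (v, u) : ℝ)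

theorem continuous_selfRate : Continuous fun z : I × I => selfRate p z.1 z.2 := by
  unfold selfRate; fun_prop

theorem continuous_crossRate : Continuous fun z : I × I => crossRate p z.1 z.2 := by
  unfold crossRate; fun_prop

/-- Merging the four integrals gives the integrand whose Riemann sum appears in `corrOp`. -/
theorem densityOp_apply (f : C(I, ℝ)) (u : I) :
    densityOp p f u = siteRate p u * f u
      + ∫ v : I, (selfRate p u v * f u + crossRate p u v * f v) := by
  have hint : ∀ {g : I → ℝ}, Continuous g → Integrable g (volume : Measure I) := fun hg =>
    hg.integrable_of_hasCompactSupport (HasCompactSupport.of_compactSpace _)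
  have h1 := hint (g := fun v => f u * ((p.lam (v, u) : ℝ) * ((p.a₄ (v, u) : ℝ) - 1)))
    (by fun_prop)
  have h2 := hint (g := fun v => f u * ((p.lam (u, v) : ℝ) * ((p.a₁ (u, v) : ℝ) - 1)))
    (by fun_prop)
  have h3 := hint (g := fun v => (p.lam (u, v) : ℝ) * (p.a₂ (u, v) : ℝ) * f v) (by fun_prop)
  have h4 := hint (g := fun v => (p.lam (v, u) : ℝ) * (p.a₃ (v, u) : ℝ) * f v) (by fun_prop)
  have e : ∀ v, selfRate p u v * f u + crossRate p u v * f v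
      = (f u * ((p.lam (v, u) : ℝ) * ((p.a₄ (v, u) : ℝ) - 1))
        + f u * ((p.lam (u, v) : ℝ) * ((p.a₁ (u, v) : ℝ) - 1)))
        + ((p.lam (u, v) : ℝ) * (p.a₂ (u, v) : ℝ) * f v
        + (p.lam (v, u) : ℝ) * (p.a₃ (v, u) : ℝ) * f v) := fun v => by
    unfold selfRate crossRate
    ring
  have h12 : Integrable (fun v => f u * ((p.lam (v, u) : ℝ) * ((p.a₄ (v, u) : ℝ) - 1))
        + f u * ((p.lam (u, v) : ℝ) * ((p.a₁ (u, v) : ℝ) - 1))) (volume : Measure I) := h1.add h2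
  have h34 : Integrable (fun v => (p.lam (u, v) : ℝ) * (p.a₂ (u, v) : ℝ) * f v
        + (p.lam (v, u) : ℝ) * (p.a₃ (v, u) : ℝ) * f v) (volume : Measure I) := h3.add h4
  simp_rw [e]
  rw [integral_add h12 h34, integral_add h1 h2, integral_add h3 h4,
    integral_const_mul, integral_const_mul]
  simp only [densityOp, ContinuousMap.coe_mk, siteRate]
  ring

variable {p} {K : ℝ}

theorem Coeffs.IsBound.abs_siteRate_le (hK : p.IsBound K) (u : I) : |siteRate p u| ≤ K ^ 2 := by
  unfold siteRate
  rw [abs_mul, NNReal.abs_eq, sq]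
  have h1 := hK.one_le
  refine mul_le_mul (hK.b u) ?_ (abs_nonneg _) (by linarith)
  rw [abs_le]
  constructor <;> linarith [hK.c u, NNReal.coe_nonneg (p.c u)]

theorem Coeffs.IsBound.abs_selfRate_le (hK : p.IsBound K) (u v : I) :
    |selfRate p u v| ≤ 2 * K ^ 2 := by
  unfold selfRate
  have h1 := hK.one_le
  have h : ∀ l a : ℝ≥0, (l : ℝ) ≤ K → (a : ℝ) ≤ K → |(l : ℝ) * ((a : ℝ) - 1)| ≤ K ^ 2 :=
    fun l a hl ha => by
      rw [abs_mul, NNReal.abs_eq, sq]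
      refine mul_le_mul hl ?_ (abs_nonneg _) (by linarith)
      rw [abs_le]
      constructor <;> linarith [NNReal.coe_nonneg a]
  refine (abs_add_le _ _).trans ?_
  linarith [h _ _ (hK.lam (v, u)) (hK.a₄ (v, u)), h _ _ (hK.lam (u, v)) (hK.a₁ (u, v))]

theorem Coeffs.IsBound.abs_crossRate_le (hK : p.IsBound K) (u v : I) :
    |crossRate p u v| ≤ 2 * K ^ 2 := by
  unfold crossRate
  have h1 := hK.one_le
  have h : ∀ l a : ℝ≥0, (l : ℝ) ≤ K → (a : ℝ) ≤ K → |(l : ℝ) * (a : ℝ)| ≤ K ^ 2 :=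
    fun l a hl ha => by
      rw [abs_mul, NNReal.abs_eq, NNReal.abs_eq, sq]
      exact mul_le_mul hl ha (NNReal.coe_nonneg _) (by linarith)
  refine (abs_add_le _ _).trans ?_
  linarith [h _ _ (hK.lam (u, v)) (hK.a₂ (u, v)), h _ _ (hK.lam (v, u)) (hK.a₃ (v, u))]

end Rates

section CorrelationOperator
variable (p : Coeffs) {N : ℕ}

/-- The operator that drives the correlations `s ↦ E ∏ₛ X` up to an error of order `1 / N`. -/
noncomputable def corrOp (w : Finset (Fin N) → ℝ) (s : Finset (Fin N)) : ℝ :=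
  ∑ k ∈ s, (siteRate p (site k) * w s + (1 / (N : ℝ)) * ∑ j ∈ sᶜ,
    (selfRate p (site k) (site j) * w s + crossRate p (site k) (site j) * w (insert j (s.erase k))))

theorem corrOp_sub (w w' : Finset (Fin N) → ℝ) (s : Finset (Fin N)) :
    corrOp p w s - corrOp p w' s = corrOp p (fun s => w s - w' s) s := by
  unfold corrOp
  rw [← Finset.sum_sub_distrib]
  refine Finset.sum_congr rfl fun k _ => ?_
  rw [add_sub_add_comm, ← mul_sub, ← mul_sub, ← Finset.sum_sub_distrib]
  congr 2
  refine Finset.sum_congr rfl fun j _ => ?_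
  ring

theorem card_insert_erase {s : Finset (Fin N)} {k j : Fin N} (hk : k ∈ s) (hj : j ∉ s) :
    (insert j (s.erase k)).card = s.card := by
  rw [Finset.card_insert_of_notMem (fun h => hj (Finset.mem_of_mem_erase h)),
    Finset.card_erase_add_one hk]

variable {p} {K : ℝ}

/-- Exchanging an urn of `s` for one outside keeps the cardinality, so only sets of size `n` occur.
Each of the `n` urns contributes `K²` from `siteRate` and `2K² + 2K²` from the averaged pair rates.
Independence of `N` is what Grönwall's inequality needs. -/
theorem Coeffs.IsBound.abs_corrOp_le (hK : p.IsBound K) {n : ℕ} {w : Finset (Fin N) → ℝ} {B : ℝ}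
    (hB : 0 ≤ B) (hw : ∀ s, s.card = n → |w s| ≤ B) {s : Finset (Fin N)} (hs : s.card = n) :
    |corrOp p w s| ≤ 5 * n * K ^ 2 * B := by
  unfold corrOp
  have hterm : ∀ k ∈ s, |siteRate p (site k) * w s + (1 / (N : ℝ)) * ∑ j ∈ sᶜ,
    (selfRate p (site k) (site j) * w s
      + crossRate p (site k) (site j) * w (insert j (s.erase k)))| ≤ 5 * K ^ 2 * B := by
    intro k hk
    have hN : (0 : ℝ) < N := Nat.cast_pos.2 (Nat.pos_of_ne_zero fun h => by subst h; exact k.elim0)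
    have h1 : |siteRate p (site k) * w s| ≤ K ^ 2 * B := by
      rw [abs_mul]
      exact mul_le_mul (hK.abs_siteRate_le _) (hw s hs) (abs_nonneg _) (by positivity)
    have h2 : |∑ j ∈ sᶜ, (selfRate p (site k) (site j) * w s
        + crossRate p (site k) (site j) * w (insert j (s.erase k)))| ≤ N * (4 * K ^ 2 * B) := by
      refine (Finset.abs_sum_le_sum_abs _ _).trans ?_
      refine (Finset.sum_le_card_nsmul _ _ (4 * K ^ 2 * B) fun j hj => ?_).trans ?_
      · refine (abs_add_le _ _).trans ?_
        rw [abs_mul, abs_mul]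
        have h3 := mul_le_mul (hK.abs_selfRate_le (site k) (site j)) (hw s hs) (abs_nonneg _)
          (by positivity)
        have h4 := mul_le_mul (hK.abs_crossRate_le (site k) (site j))
          (hw (insert j (s.erase k)) ((card_insert_erase hk (Finset.mem_compl.1 hj)).trans hs))
          (abs_nonneg _) (by positivity)
        linarith
      · rw [nsmul_eq_mul]
        refine mul_le_mul_of_nonneg_right (Nat.cast_le.2 ?_) (by positivity)
        exact (Finset.card_le_univ _).trans_eq (Fintype.card_fin N)
    refine (abs_add_le _ _).trans ?_
    rw [abs_mul (1 / (N : ℝ)), abs_of_nonneg (by positivity : (0 : ℝ) ≤ 1 / N)]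
    have h5 := mul_le_mul_of_nonneg_left h2 (by positivity : (0 : ℝ) ≤ 1 / N)
    have h6 : 1 / (N : ℝ) * (N * (4 * K ^ 2 * B)) = 4 * K ^ 2 * B := by field_simp
    linarith
  refine (Finset.abs_sum_le_sum_abs _ _).trans
    ((Finset.sum_le_card_nsmul _ _ _ hterm).trans_eq ?_)
  rw [hs, nsmul_eq_mul]
  ring

end CorrelationOperator

section Monomials
variable (p : Coeffs) {N : ℕ}

/-- The contribution to `L (∏ₛ x)` of the pair jumps with both urns in `s`. -/
noncomputable def innerPairTerm (s : Finset (Fin N)) (x : Fin N → ℝ≥0) : ℝ :=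
  (1 / (N : ℝ)) * ∑ i ∈ s, ∑ j ∈ s.erase i,
    (p.lam (site i, site j) : ℝ) * (∏ k ∈ s, (pairJump p i j x k : ℝ) - ∏ k ∈ s, (x k : ℝ))

theorem prod_insert_erase {s : Finset (Fin N)} {k j : Fin N} (hj : j ∉ s) (y : Fin N → ℝ) :
    ∏ l ∈ insert j (s.erase k), y l = y j * ∏ l ∈ s.erase k, y l :=
  Finset.prod_insert fun h => hj (Finset.mem_of_mem_erase h)

/-- A jump of `i ∈ s` with `j ∉ s` alters a single factor, replacing `x i` by a linear combination
of `x i` and `x j`. The orientation `(i, j)` contributes `a₁, a₂` and `(j, i)` contributes `a₄, a₃`,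
which is how `selfRate` and `crossRate` arise. -/
theorem generator_monomial (s : Finset (Fin N)) (x : Fin N → ℝ≥0) :
    generator p N (fun y => ∏ k ∈ s, (y k : ℝ)) x
      = corrOp p (fun s => ∏ k ∈ s, (x k : ℝ)) s + innerPairTerm p s x := by
  rw [generator_of_dependsOn p s fun x y h => Finset.prod_congr rfl fun k hk => by rw [h k hk]]
  rw [mul_add, ← add_assoc]
  refine congrArg₂ (· + ·) ?_ rfl
  unfold corrOp
  rw [Finset.sum_add_distrib, ← Finset.mul_sum]
  congr 1
  · refine Finset.sum_congr rfl fun i hi => ?_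
    have hx := Finset.mul_prod_erase s (fun k => (x k : ℝ)) hi
    have hj := Finset.mul_prod_erase s (fun k => (singleJump p i x k : ℝ)) hi
    have he : ∏ k ∈ s.erase i, (singleJump p i x k : ℝ) = ∏ k ∈ s.erase i, (x k : ℝ) :=
      Finset.prod_congr rfl fun k hk => by rw [singleJump_of_ne p x (Finset.ne_of_mem_erase hk)]
    simp only at hx hj ⊢
    rw [← hx, ← hj, he, singleJump_self]
    unfold siteRate
    push_cast
    ring
  · congr 1
    refine Finset.sum_congr rfl fun i hi => Finset.sum_congr rfl fun j hj => ?_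
    have hj' := Finset.mem_compl.1 hj
    have hji : i ≠ j := fun h => hj' (h ▸ hi)
    have hx := Finset.mul_prod_erase s (fun k => (x k : ℝ)) hi
    have h1 := Finset.mul_prod_erase s (fun k => (pairJump p i j x k : ℝ)) hi
    have h2 := Finset.mul_prod_erase s (fun k => (pairJump p j i x k : ℝ)) hi
    have hne : ∀ k ∈ s.erase i, k ≠ i ∧ k ≠ j := fun k hk =>
      ⟨Finset.ne_of_mem_erase hk, fun h => hj' (h ▸ Finset.mem_of_mem_erase hk)⟩
    have he1 : ∏ k ∈ s.erase i, (pairJump p i j x k : ℝ) = ∏ k ∈ s.erase i, (x k : ℝ) :=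
      Finset.prod_congr rfl fun k hk => by rw [pairJump_of_ne p x (hne k hk).1 (hne k hk).2]
    have he2 : ∏ k ∈ s.erase i, (pairJump p j i x k : ℝ) = ∏ k ∈ s.erase i, (x k : ℝ) :=
      Finset.prod_congr rfl fun k hk => by rw [pairJump_of_ne p x (hne k hk).2 (hne k hk).1]
    simp only at hx h1 h2 ⊢
    rw [prod_insert_erase hj' (fun k => (x k : ℝ)), ← hx, ← h1, ← h2, he1, he2, pairJump_left,
      pairJump_right p x hji]
    unfold selfRate crossRate
    push_cast
    ring

theorem prod_le_pow_four {s : Finset (Fin N)} (hs : s.card ≤ 4) {y : Fin N → ℝ≥0} {m : ℝ}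
    (hm : 1 ≤ m) (hy : ∀ k ∈ s, (y k : ℝ) ≤ m) : ∏ k ∈ s, (y k : ℝ) ≤ m ^ 4 :=
  ((Finset.prod_le_prod (fun _ _ => NNReal.coe_nonneg _) hy).trans_eq
    (Finset.prod_const m)).trans (pow_le_pow_right₀ hm hs)

theorem monomial_le_massWeight {s : Finset (Fin N)} (hs : s.card ≤ 4) (x : Fin N → ℝ≥0) :
    |∏ k ∈ s, (x k : ℝ)| ≤ 1 * massWeight x := by
  rw [one_mul, abs_of_nonneg (by positivity)]
  exact prod_le_pow_four hs (le_add_of_nonneg_right (by positivity))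
    fun k _ => coe_le_one_add_sum x k

/-- Here `512 = 8 * 4³`, from `(1 + S)⁴ ≤ 8 (1 + S⁴)` and the power mean inequality over at most
four terms. -/
theorem one_add_sum_pow_four_le {s : Finset (Fin N)} (hs : s.card ≤ 4) (x : Fin N → ℝ≥0) :
    (1 + ∑ k ∈ s, (x k : ℝ)) ^ 4 ≤ 512 * (1 + ∑ k ∈ s, (x k : ℝ) ^ 4) := by
  have h1 := add_pow_le zero_le_one (by positivity : 0 ≤ ∑ k ∈ s, (x k : ℝ)) 4
  have h2 := pow_sum_le_card_mul_sum_pow (s := s) (f := fun k => (x k : ℝ))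
    (fun k _ => NNReal.coe_nonneg _) 3
  have h3 : ((s.card : ℝ)) ^ 3 ≤ 4 ^ 3 :=
    pow_le_pow_left₀ (Nat.cast_nonneg _) (by exact_mod_cast hs) 3
  have h4 : 0 ≤ ∑ k ∈ s, (x k : ℝ) ^ 4 := by positivity
  norm_num at h1 h2 h3
  nlinarith [mul_le_mul_of_nonneg_right h3 h4]

variable {p} {K : ℝ}

/-- There are at most `16` ordered pairs inside `s`. Both products are nonnegative and at most the
fourth power of `2K(1 + S)`, with `S` the mass in `s` alone, so the bound involves at most four
fourth powers whatever `N` is. -/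
theorem Coeffs.IsBound.abs_innerPairTerm_le (hK : p.IsBound K) {s : Finset (Fin N)}
    (hs : s.card ≤ 4) (x : Fin N → ℝ≥0) :
    |innerPairTerm p s x| ≤ (1 / (N : ℝ)) *
      (16 * K * (2 * K) ^ 4 * (512 * (1 + ∑ k ∈ s, (x k : ℝ) ^ 4))) := by
  have h1 := hK.one_le
  set B := K * (2 * K) ^ 4 * (512 * (1 + ∑ k ∈ s, (x k : ℝ) ^ 4))
  have hB : 0 ≤ B := by positivity
  have hcard : (s.card : ℝ) ≤ 4 := by exact_mod_cast hs
  have hle : ∀ l ∈ s, (x l : ℝ) ≤ ∑ l ∈ s, (x l : ℝ) := fun l hl =>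
    Finset.single_le_sum (f := fun l => (x l : ℝ)) (fun _ _ => NNReal.coe_nonneg _) hl
  have hS : 0 ≤ ∑ l ∈ s, (x l : ℝ) := by positivity
  have hm : 1 ≤ 2 * K * (1 + ∑ l ∈ s, (x l : ℝ)) := by nlinarith
  have hpow : (2 * K * (1 + ∑ l ∈ s, (x l : ℝ))) ^ 4
      ≤ (2 * K) ^ 4 * (512 * (1 + ∑ k ∈ s, (x k : ℝ) ^ 4)) := by
    rw [mul_pow]
    exact mul_le_mul_of_nonneg_left (one_add_sum_pow_four_le hs x) (by positivity)
  have hterm : ∀ i ∈ s, ∀ j ∈ s.erase i, |(p.lam (site i, site j) : ℝ) *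
      (∏ k ∈ s, (pairJump p i j x k : ℝ) - ∏ k ∈ s, (x k : ℝ))| ≤ B := by
    intro i hi j hj
    have e1 : ∏ k ∈ s, (pairJump p i j x k : ℝ) ≤ (2 * K * (1 + ∑ l ∈ s, (x l : ℝ))) ^ 4 :=
      prod_le_pow_four hs hm fun k hk =>
        (hK.pairJump_le_sum hi (Finset.mem_of_mem_erase hj) hk x).trans (by nlinarith)
    have e2 : ∏ k ∈ s, (x k : ℝ) ≤ (2 * K * (1 + ∑ l ∈ s, (x l : ℝ))) ^ 4 :=
      prod_le_pow_four hs hm fun k hk => by nlinarith [hle k hk]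
    have e3 : 0 ≤ ∏ k ∈ s, (pairJump p i j x k : ℝ) := by positivity
    have e4 : 0 ≤ ∏ k ∈ s, (x k : ℝ) := by positivity
    rw [abs_mul, NNReal.abs_eq]
    simp only [B]
    rw [mul_assoc K]
    refine mul_le_mul (hK.lam _) ?_ (abs_nonneg _) (by positivity)
    rw [abs_le]
    constructor <;> linarith
  unfold innerPairTerm
  rw [abs_mul, abs_of_nonneg (by positivity : (0 : ℝ) ≤ 1 / N)]
  refine mul_le_mul_of_nonneg_left ?_ (by positivity)
  have hinner : ∀ i ∈ s, |∑ j ∈ s.erase i, (p.lam (site i, site j) : ℝ) *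
      (∏ k ∈ s, (pairJump p i j x k : ℝ) - ∏ k ∈ s, (x k : ℝ))| ≤ 4 * B := fun i hi => by
    refine (Finset.abs_sum_le_sum_abs _ _).trans
      ((Finset.sum_le_card_nsmul _ _ _ (hterm i hi)).trans ?_)
    rw [nsmul_eq_mul]
    refine mul_le_mul_of_nonneg_right (le_trans ?_ hcard) hB
    exact_mod_cast Finset.card_le_card (Finset.erase_subset i s)
  calc _ ≤ s.card • (4 * B) := (Finset.abs_sum_le_sum_abs _ _).trans
        (Finset.sum_le_card_nsmul _ _ _ hinner)
    _ ≤ 4 * (4 * B) := by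
        rw [nsmul_eq_mul]
        exact mul_le_mul_of_nonneg_right hcard (by positivity)
    _ = _ := by simp only [B]; ring

end Monomials

section Correlations
variable {p : Coeffs} {K : ℝ} {φ : C(I, ℝ)} {N : ℕ} {Ω : Type*} [MeasurableSpace Ω]
  {P : Measure Ω} {X : ℝ≥0 → Ω → (Fin N → ℝ≥0)}

theorem measurable_monomial (s : Finset (Fin N)) :
    Measurable fun x : Fin N → ℝ≥0 => ∏ k ∈ s, (x k : ℝ) := by fun_prop

theorem IsUrnLinearSystem.integrable_massWeight [IsProbabilityMeasure P]
    (hX : IsUrnLinearSystem p N P X)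
    (hA : InitialAssumption φ N P (X 0)) (hK : p.IsBound K) (t : ℝ≥0) :
    Integrable (fun ω => massWeight (X t ω)) P :=
  hX.integrable_weight (hK.isJumpWeight_massWeight N)
    (hA.integrable_massWeight (hX.measurable 0)) t

theorem IsUrnLinearSystem.integrable_monomial [IsProbabilityMeasure P]
    (hX : IsUrnLinearSystem p N P X)
    (hA : InitialAssumption φ N P (X 0)) (hK : p.IsBound K) {s : Finset (Fin N)}
    (hs : s.card ≤ 4) (t : ℝ≥0) : Integrable (fun ω => ∏ k ∈ s, (X t ω k : ℝ)) P :=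
  integrable_comp_of_le (measurable_monomial s) (monomial_le_massWeight hs) (hX.measurable t)
    (hX.integrable_massWeight hA hK t)

theorem integral_corrOp {w : Ω → Finset (Fin N) → ℝ} {s : Finset (Fin N)}
    (hw : ∀ s' : Finset (Fin N), s'.card = s.card → Integrable (fun ω => w ω s') P) :
    Integrable (fun ω => corrOp p (w ω) s) P ∧
      ∫ ω, corrOp p (w ω) s ∂P = corrOp p (fun s => ∫ ω, w ω s ∂P) s := by
  have h1 : ∀ k ∈ s, ∀ j ∈ sᶜ, Integrable (fun ω => selfRate p (site k) (site j) * w ω s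
      + crossRate p (site k) (site j) * w ω (insert j (s.erase k))) P := fun k hk j hj =>
    ((hw s rfl).const_mul _).add
      ((hw _ (card_insert_erase hk (Finset.mem_compl.1 hj))).const_mul _)
  have h2 : ∀ k ∈ s, Integrable (fun ω => (1 / (N : ℝ)) * ∑ j ∈ sᶜ,
      (selfRate p (site k) (site j) * w ω s
        + crossRate p (site k) (site j) * w ω (insert j (s.erase k)))) P := fun k hk =>
    (integrable_finsetSum _ (h1 k hk)).const_mul _
  have h3 : ∀ k ∈ s, Integrable (fun ω => siteRate p (site k) * w ω s) P := fun k _ =>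
    (hw s rfl).const_mul _
  have h4 : ∀ k ∈ s, Integrable (fun ω => siteRate p (site k) * w ω s
      + (1 / (N : ℝ)) * ∑ j ∈ sᶜ, (selfRate p (site k) (site j) * w ω s
        + crossRate p (site k) (site j) * w ω (insert j (s.erase k)))) P := fun k hk =>
    (h3 k hk).add (h2 k hk)
  unfold corrOp
  refine ⟨integrable_finsetSum _ h4, ?_⟩
  rw [integral_finsetSum _ h4]
  refine Finset.sum_congr rfl fun k hk => ?_
  rw [integral_add (h3 k hk) (h2 k hk), integral_const_mul, integral_const_mul,
    integral_finsetSum _ (h1 k hk)]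
  congr 2
  refine Finset.sum_congr rfl fun j hj => ?_
  rw [integral_add ((hw s rfl).const_mul _)
    ((hw _ (card_insert_erase hk (Finset.mem_compl.1 hj))).const_mul _),
    integral_const_mul, integral_const_mul]

/-- The correlations of order at most `4` evolve by `corrOp`, up to an error of order `1 / N`. -/
theorem IsUrnLinearSystem.hasDerivWithinAt_correlation [IsProbabilityMeasure P]
    (hX : IsUrnLinearSystem p N P X)
    (hA : InitialAssumption φ N P (X 0)) (hK : p.IsBound K) {s : Finset (Fin N)}
    (hs : s.card ≤ 4) {t : ℝ} (ht : 0 ≤ t) :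
    ∃ r : ℝ, |r| ≤ (1 / (N : ℝ)) *
        (16 * K * (2 * K) ^ 4 * (512 * (1 + 8 * Real.exp (51 * K ^ 5 * t)))) ∧
      HasDerivWithinAt (fun t : ℝ => ∫ ω, ∏ k ∈ s, (X t.toNNReal ω k : ℝ) ∂P)
        (corrOp p (fun s => ∫ ω, ∏ k ∈ s, (X t.toNNReal ω k : ℝ) ∂P) s + r) (Set.Ici 0) t := by
  have h1 := hK.one_le
  have hd := hX.hasDerivWithinAt (hK.isJumpWeight_massWeight N)
    (hA.integrable_massWeight (hX.measurable 0)) (measurable_monomial s) zero_le_one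
    (monomial_le_massWeight hs) ht
  set Y := X t.toNNReal with hY
  have hgi : Integrable (fun ω => generator p N (fun y => ∏ k ∈ s, (y k : ℝ)) (Y ω)) P :=
    integrable_comp_of_le (measurable_generator p (measurable_monomial s))
      ((hK.isJumpWeight_massWeight N).abs_generator_le zero_le_one (monomial_le_massWeight hs))
      (hX.measurable _) (hX.integrable_massWeight hA hK _)
  obtain ⟨hci, hce⟩ := integral_corrOp (p := p) (P := P) (s := s)
    (w := fun ω s => ∏ k ∈ s, (Y ω k : ℝ))
    (fun s' hs' => hX.integrable_monomial hA hK (hs'.trans_le hs) _)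
  -- Written as a difference of two integrable functions, the error term can be integrated without
  -- expanding it.
  have hpe : ∀ ω, innerPairTerm p s (Y ω) = generator p N (fun y => ∏ k ∈ s, (y k : ℝ)) (Y ω)
      - corrOp p (fun s => ∏ k ∈ s, (Y ω k : ℝ)) s := fun ω => by
    rw [generator_monomial]; ring
  refine ⟨∫ ω, innerPairTerm p s (Y ω) ∂P, ?_, ?_⟩
  · have hm := fun k => hX.fourth_moment hA hK k t.toNNReal
    have hbi : Integrable (fun ω => (1 / (N : ℝ)) *
      (16 * K * (2 * K) ^ 4 * (512 * (1 + ∑ k ∈ s, (Y ω k : ℝ) ^ 4)))) P :=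
      ((((integrable_const _).add (integrable_finsetSum _ fun k _ => (hm k).1)).const_mul
        _).const_mul _).const_mul _
    have := norm_integral_le_of_norm_le (f := fun ω => innerPairTerm p s (Y ω)) hbi
      (ae_of_all _ fun ω => hK.abs_innerPairTerm_le hs (Y ω))
    refine this.trans ?_
    rw [integral_const_mul, integral_const_mul, integral_const_mul,
      integral_add (integrable_const _) (integrable_finsetSum _ fun k _ => (hm k).1),
      integral_finsetSum _ fun k _ => (hm k).1]
    -- At most four urns, each with the factor `2` of `fourth_moment`.
    have hsum : ∑ k ∈ s, ∫ ω, (Y ω k : ℝ) ^ 4 ∂P ≤ 8 * Real.exp (51 * K ^ 5 * t) := by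
      refine (Finset.sum_le_card_nsmul _ _ _ fun k _ => (hm k).2).trans ?_
      rw [nsmul_eq_mul, Real.coe_toNNReal t ht]
      have : (s.card : ℝ) ≤ 4 := by exact_mod_cast hs
      nlinarith [Real.exp_pos (51 * K ^ 5 * t)]
    simp only [integral_const, probReal_univ, one_smul]
    gcongr
  · have : corrOp p (fun s => ∫ ω, ∏ k ∈ s, (Y ω k : ℝ) ∂P) s + ∫ ω, innerPairTerm p s (Y ω) ∂P
        = ∫ ω, generator p N (fun y => ∏ k ∈ s, (y k : ℝ)) (Y ω) ∂P := by
      simp_rw [hpe]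
      rw [integral_sub hgi hci, hce]
      ring
    rw [this]
    exact hd

end Correlations

end UrnSystem

/-! ### Hydrodynamic density, Grönwall's inequality, and propagation of chaos. -/

namespace UrnSystem

section Density
variable {p : Coeffs} {φ : C(I, ℝ)} {ρ : ℝ → C(I, ℝ)}

theorem IsHydrodynamicDensity.continuous (hρ : IsHydrodynamicDensity p φ ρ) :
    Continuous fun t : ℝ≥0 => ρ t :=
  ContinuousOn.comp_continuous (s := Set.Ici 0)
    (fun t ht => (hρ.deriv t ht).continuousWithinAt) NNReal.continuous_coe fun t => t.2

theorem IsHydrodynamicDensity.exists_bound (hρ : IsHydrodynamicDensity p φ ρ) (T : ℝ≥0) :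
    ∃ R : ℝ, 1 ≤ R ∧ ∀ t : ℝ≥0, t ≤ T → ∀ u, |ρ t u| ≤ R := by
  obtain ⟨C, hC⟩ := (isCompact_Icc (a := (0 : ℝ≥0)) (b := T)).exists_bound_of_continuousOn
    hρ.continuous.continuousOn
  exact ⟨max 1 C, le_max_left _ _, fun t ht u =>
    ((ρ t).norm_coe_le_norm u).trans ((hC t ⟨zero_le, ht⟩).trans (le_max_right _ _))⟩

theorem IsHydrodynamicDensity.hasDerivWithinAt_prod (hρ : IsHydrodynamicDensity p φ ρ) {N : ℕ}
    (s : Finset (Fin N)) {t : ℝ} (ht : 0 ≤ t) :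
    HasDerivWithinAt (fun t => ∏ k ∈ s, ρ t (site k))
      (∑ k ∈ s, (∏ j ∈ s.erase k, ρ t (site j)) * densityOp p (ρ t) (site k)) (Set.Ici 0) t := by
  have h : ∀ u : I, HasDerivWithinAt (fun t => ρ t u) (densityOp p (ρ t) u) (Set.Ici 0) t :=
    fun u => (ContinuousMap.evalCLM ℝ u : C(I, ℝ) →L[ℝ] ℝ).hasFDerivAt.comp_hasDerivWithinAt t
      (hρ.deriv t ht)
  simpa [smul_eq_mul] using HasDerivWithinAt.fun_finsetProd (u := s) fun k _ => h (site k)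

/-- Products of the hydrodynamic density evolve by `corrOp`, up to the error of Riemann sums. -/
theorem Coeffs.IsBound.abs_prod_density_sub_corrOp_le {K : ℝ} (hK : p.IsBound K) {f : C(I, ℝ)}
    {R ε : ℝ} (hR : 1 ≤ R) (hf : ∀ u, |f u| ≤ R) {N : ℕ} (hε : ∀ u, |(1 / (N : ℝ)) * ∑ j : Fin N,
      (selfRate p u (site j) * f u + crossRate p u (site j) * f (site j))
      - ∫ v : I, (selfRate p u v * f u + crossRate p u v * f v)| ≤ ε)
    {s : Finset (Fin N)} (hs : s.card ≤ 4) :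
    |∑ k ∈ s, (∏ j ∈ s.erase k, f (site j)) * densityOp p f (site k)
      - corrOp p (fun s => ∏ k ∈ s, f (site k)) s|
        ≤ 4 * (R ^ 4 * (ε + (1 / (N : ℝ)) * (16 * K ^ 2 * R))) := by
  have hε0 : 0 ≤ ε := (abs_nonneg _).trans (hε 0)
  set F : I → I → ℝ := fun u v => selfRate p u v * f u + crossRate p u v * f v with hF
  have hFb : ∀ u v, |F u v| ≤ 4 * K ^ 2 * R := fun u v => by
    refine (abs_add_le _ _).trans ?_
    rw [abs_mul, abs_mul]
    have h1 := mul_le_mul (hK.abs_selfRate_le u v) (hf u) (abs_nonneg _) (by positivity)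
    have h2 := mul_le_mul (hK.abs_crossRate_le u v) (hf v) (abs_nonneg _) (by positivity)
    linarith
  have hcard : (s.card : ℝ) ≤ 4 := by exact_mod_cast hs
  have hterm : ∀ k ∈ s, |(∏ j ∈ s.erase k, f (site j)) * densityOp p f (site k)
      - (siteRate p (site k) * ∏ k ∈ s, f (site k) + (1 / (N : ℝ)) * ∑ j ∈ sᶜ,
        (selfRate p (site k) (site j) * ∏ k ∈ s, f (site k)
          + crossRate p (site k) (site j) * ∏ l ∈ insert j (s.erase k), f (site l)))|
      ≤ R ^ 4 * (ε + (1 / (N : ℝ)) * (16 * K ^ 2 * R)) := by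
    intro k hk
    set Q := ∏ j ∈ s.erase k, f (site j) with hQ
    have hsQ : ∏ k ∈ s, f (site k) = f (site k) * Q := (Finset.mul_prod_erase s _ hk).symm
    have hsum : ∑ j ∈ sᶜ, (selfRate p (site k) (site j) * ∏ k ∈ s, f (site k)
          + crossRate p (site k) (site j) * ∏ l ∈ insert j (s.erase k), f (site l))
        = Q * ∑ j ∈ sᶜ, F (site k) (site j) := by
      rw [Finset.mul_sum]
      refine Finset.sum_congr rfl fun j hj => ?_
      rw [prod_insert_erase (Finset.mem_compl.1 hj) (fun l => f (site l)), hsQ]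
      simp only [hF]
      ring
    have hcompl := Finset.sum_add_sum_compl s fun j => F (site k) (site j)
    -- The Riemann sum runs over all urns while `corrOp` omits those in `s`; at most four missing
    -- terms cost `O(1/N)`.
    have hin : |∑ j ∈ s, F (site k) (site j)| ≤ 16 * K ^ 2 * R := by
      refine (Finset.abs_sum_le_sum_abs _ _).trans
        ((Finset.sum_le_card_nsmul _ _ _ fun j _ => hFb _ _).trans ?_)
      rw [nsmul_eq_mul]
      have : 0 ≤ K ^ 2 * R := by positivity
      nlinarith
    have hQR : |Q| ≤ R ^ 4 := by
      rw [hQ, Finset.abs_prod]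
      refine ((Finset.prod_le_prod (fun _ _ => abs_nonneg _) fun j _ => hf (site j)).trans_eq
        (Finset.prod_const R)).trans (pow_le_pow_right₀ hR ?_)
      exact (Finset.card_le_card (Finset.erase_subset k s)).trans hs
    have hid : Q * densityOp p f (site k) - (siteRate p (site k) * ∏ k ∈ s, f (site k)
        + (1 / (N : ℝ)) * ∑ j ∈ sᶜ, (selfRate p (site k) (site j) * ∏ k ∈ s, f (site k)
          + crossRate p (site k) (site j) * ∏ l ∈ insert j (s.erase k), f (site l)))
        = Q * (-((1 / (N : ℝ)) * ∑ j : Fin N, F (site k) (site j) - ∫ v, F (site k) v)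
          + (1 / (N : ℝ)) * ∑ j ∈ s, F (site k) (site j)) := by
      rw [hsum, densityOp_apply, hsQ, ← hcompl]
      ring
    rw [hid, abs_mul]
    refine mul_le_mul hQR ((abs_add_le _ _).trans ?_) (abs_nonneg _) (by positivity)
    rw [abs_neg, abs_mul (1 / (N : ℝ)), abs_of_nonneg (by positivity : (0 : ℝ) ≤ 1 / N)]
    exact add_le_add (hε _) (mul_le_mul_of_nonneg_left hin (by positivity))
  unfold corrOp
  rw [← Finset.sum_sub_distrib]
  refine (Finset.abs_sum_le_sum_abs _ _).trans
    ((Finset.sum_le_card_nsmul _ _ _ hterm).trans ?_)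
  rw [nsmul_eq_mul]
  exact mul_le_mul_of_nonneg_right hcard (by positivity)

end Density

/-- Grönwall's inequality from zero initial value gives `(η / C)(e^{Ct} - 1)`; the assumption `1 ≤
C` removes the division. -/
theorem norm_le_mul_exp_of_deriv_bound {E : Type*} [NormedAddCommGroup E] [NormedSpace ℝ E]
    {u u' : ℝ → E} {C η T : ℝ} (hC : 1 ≤ C) (hη : 0 ≤ η) (h0 : u 0 = 0)
    (hu : ∀ t, 0 ≤ t → HasDerivWithinAt u (u' t) (Set.Ici 0) t)
    (hb : ∀ t, 0 ≤ t → t ≤ T → ‖u' t‖ ≤ C * ‖u t‖ + η) {t : ℝ} (ht : 0 ≤ t) (htT : t ≤ T) :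
    ‖u t‖ ≤ η * Real.exp (C * T) := by
  have h := norm_le_gronwallBound_of_norm_deriv_right_le (f := u) (f' := u') (δ := 0) (K := C)
    (ε := η) (a := 0) (b := T)
    (fun s hs => ((hu s hs.1).continuousWithinAt).mono fun _ h => h.1)
    (fun s hs => (hu s hs.1).mono (Set.Ici_subset_Ici.2 hs.1)) (by simp [h0])
    (fun s hs => hb s hs.1 hs.2.le) t ⟨ht, htT⟩
  refine h.trans ?_
  rw [gronwallBound_of_K_ne_0 (by positivity)]
  simp only [sub_zero, zero_mul, zero_add]
  have h1 : Real.exp (C * t) ≤ Real.exp (C * T) :=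
    Real.exp_le_exp.2 (mul_le_mul_of_nonneg_left htT (by positivity))
  have h2 : η / C ≤ η := div_le_self hη hC
  have h3 : 0 ≤ Real.exp (C * t) - 1 := by
    have := Real.one_le_exp (by positivity : 0 ≤ C * t)
    linarith
  exact mul_le_mul h2 (by linarith) h3 hη

section Convergence
variable {p : Coeffs} {φ : C(I, ℝ)} {Ω : ℕ → Type*} [∀ N, MeasurableSpace (Ω N)]
  {P : ∀ N, Measure (Ω N)} [∀ N, IsProbabilityMeasure (P N)]
  {X : ∀ N, ℝ≥0 → Ω N → (Fin N → ℝ≥0)} {ρ : ℝ → C(I, ℝ)}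

/-- Propagation of chaos: correlations of order at most `4` at distinct urns converge to products
of the hydrodynamic density, uniformly in the urns and on compact time intervals. -/
theorem eventually_abs_correlation_sub_le (hX : ∀ N, IsUrnLinearSystem p N (P N) (X N))
    (hA : ∀ N, InitialAssumption φ N (P N) (X N 0)) (hρ : IsHydrodynamicDensity p φ ρ) (T : ℝ≥0)
    {n : ℕ} (hn : n ≤ 4) {ε : ℝ} (hε : 0 < ε) :
    ∀ᶠ N : ℕ in atTop, ∀ t : ℝ≥0, t ≤ T → ∀ s : Finset (Fin N), s.card = n →
      |∫ ω, ∏ k ∈ s, (X N t ω k : ℝ) ∂(P N) - ∏ k ∈ s, ρ t (site k)| ≤ ε := by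
  obtain ⟨K, hK⟩ := p.exists_isBound
  obtain ⟨R, hR, hρR⟩ := hρ.exists_bound T
  have hK1 := hK.one_le
  -- The first summand bounds `corrOp` on sets of size `n`; the `1` ensures `1 ≤ C` even for `n =
  -- 0`.
  set C : ℝ := 5 * n * K ^ 2 + 1
  have hC : 1 ≤ C := le_add_of_nonneg_left (by positivity)
  -- Chosen so that Grönwall's bound `η * exp (C * T)` equals `ε`. Half of `η` is left to the `1/N`
  -- errors, and half to the Riemann sums through `4 * (R ^ 4 * ε') = η / 2`.
  set η := ε * Real.exp (-(C * T))
  have hη : 0 < η := by positivity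
  set A : ℝ := 16 * K * (2 * K) ^ 4 * (512 * (1 + 8 * Real.exp (51 * K ^ 5 * T)))
  set B : ℝ := 16 * K ^ 2 * R
  set ε' := η / (8 * R ^ 4)
  have hε' : 0 < ε' := by positivity
  have hcont : Continuous (Function.uncurry fun (y : Set.Icc (0 : ℝ≥0) T × I) (v : I) =>
      selfRate p y.2 v * ρ (y.1 : ℝ≥0) y.2 + crossRate p y.2 v * ρ (y.1 : ℝ≥0) v) := by
    have h1 : Continuous fun z : (Set.Icc (0 : ℝ≥0) T × I) × I => ρ (z.1.1 : ℝ≥0) :=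
      hρ.continuous.comp (by fun_prop)
    have h2 := (continuous_selfRate p).comp
      (by fun_prop : Continuous fun z : (Set.Icc (0 : ℝ≥0) T × I) × I => (z.1.2, z.2))
    have h3 := (continuous_crossRate p).comp
      (by fun_prop : Continuous fun z : (Set.Icc (0 : ℝ≥0) T × I) × I => (z.1.2, z.2))
    exact (h2.mul (h1.eval (by fun_prop))).add (h3.mul (h1.eval (by fun_prop)))
  have hlim : Tendsto (fun N : ℕ => (1 / (N : ℝ)) * (A + 4 * (R ^ 4 * B))) atTop (𝓝 0) := by
    simpa using (tendsto_one_div_atTop_nhds_zero_nat (𝕜 := ℝ)).mul_const (A + 4 * (R ^ 4 * B))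
  filter_upwards [eventually_riemannSum hcont hε', hlim.eventually (gt_mem_nhds (half_pos hη))]
    with N hN hNη t htT s hs
  have hd : ∀ (t : ℝ), 0 ≤ t → ∀ s : {s : Finset (Fin N) // s.card = n}, ∃ r : ℝ,
      |r| ≤ (1 / (N : ℝ)) * (16 * K * (2 * K) ^ 4 * (512 * (1 + 8 * Real.exp (51 * K ^ 5 * t)))) ∧
      HasDerivWithinAt (fun t : ℝ => ∫ ω, ∏ k ∈ s.1, (X N t.toNNReal ω k : ℝ) ∂(P N))
        (corrOp p (fun s => ∫ ω, ∏ k ∈ s, (X N t.toNNReal ω k : ℝ) ∂(P N)) s.1 + r)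
        (Set.Ici 0) t := fun t ht s =>
    (hX N).hasDerivWithinAt_correlation (hA N) hK (s.2.trans_le hn) ht
  choose! r hr hrd using hd
  -- The errors for all sets of size `n` form one vector in a finite product with the supremum norm,
  -- because `corrOp` couples different sets.
  set u : ℝ → {s : Finset (Fin N) // s.card = n} → ℝ := fun t s =>
    ∫ ω, ∏ k ∈ s.1, (X N t.toNNReal ω k : ℝ) ∂(P N) - ∏ k ∈ s.1, ρ t (site k) with hu
  set u' : ℝ → {s : Finset (Fin N) // s.card = n} → ℝ := fun t s =>
    corrOp p (fun s => ∫ ω, ∏ k ∈ s, (X N t.toNNReal ω k : ℝ) ∂(P N)) s.1 + r t s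
      - ∑ k ∈ s.1, (∏ j ∈ s.1.erase k, ρ t (site j)) * densityOp p (ρ t) (site k) with hu'
  have hderiv : ∀ t, 0 ≤ t → HasDerivWithinAt u (u' t) (Set.Ici 0) t := fun t ht =>
    hasDerivWithinAt_pi.2 fun s => (hrd t ht s).sub (hρ.hasDerivWithinAt_prod s.1 ht)
  have hinit : u 0 = 0 := by
    funext s
    simp only [hu, Real.toNNReal_zero, Pi.zero_apply, hρ.initial]
    rw [(hA N).integral_prod ((hX N).measurable 0), sub_self]
  have hbound : ∀ t, 0 ≤ t → t ≤ (T : ℝ) → ‖u' t‖ ≤ C * ‖u t‖ + η := by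
    intro t ht htT
    refine (pi_norm_le_iff_of_nonneg (by positivity)).2 fun s => ?_
    have htT' : t.toNNReal ≤ T := Real.toNNReal_le_iff_le_coe.2 htT
    have htt : ((t.toNNReal : ℝ≥0) : ℝ) = t := Real.coe_toNNReal t ht
    have e1 : |r t s| ≤ (1 / (N : ℝ)) * A := by
      refine (hr t ht s).trans ?_
      simp only [A]
      gcongr
    have e2 := hK.abs_prod_density_sub_corrOp_le (f := ρ t) (ε := ε') hR
      (fun u => by simpa [htt] using hρR _ htT' u)
      (fun u => by simpa [htt] using hN (⟨t.toNNReal, zero_le, htT'⟩, u))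
      (s := s.1) (s.2.trans_le hn)
    have e3 : |corrOp p (fun s => ∫ ω, ∏ k ∈ s, (X N t.toNNReal ω k : ℝ) ∂(P N)
        - ∏ k ∈ s, ρ t (site k)) s.1| ≤ 5 * n * K ^ 2 * ‖u t‖ :=
      hK.abs_corrOp_le (norm_nonneg _) (fun s' hs' => norm_le_pi_norm (u t) ⟨s', hs'⟩) s.2
    rw [← corrOp_sub] at e3
    have e4 : 4 * (R ^ 4 * ε') = η / 2 := by
      simp only [ε']
      field_simp
      norm_num
    rw [Real.norm_eq_abs, abs_le]
    rw [abs_le] at e1 e2 e3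
    simp only [hu', C, B] at *
    constructor <;> nlinarith [norm_nonneg (u t)]
  have hfin := norm_le_mul_exp_of_deriv_bound hC hη.le hinit hderiv hbound t.2
    (NNReal.coe_le_coe.2 htT)
  have hpt := (norm_le_pi_norm (u t) ⟨s, hs⟩).trans hfin
  have hηε : η * Real.exp (C * T) = ε := by
    simp only [η]
    rw [mul_assoc, ← Real.exp_add]
    simp
  rw [hηε] at hpt
  simpa [hu] using hpt

end Convergence

end UrnSystem

/-! ### Double Riemann sums and the second moment of the pair fluctuations. -/

namespace UrnSystem

/-- Uniform Riemann-sum convergence is used twice with `ε / 2`: for the inner variable with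
parameter `(y, u)`, and for the inner integral, which is continuous in `(y, u)`. -/
theorem eventually_double_riemannSum {Y : Type*} [PseudoMetricSpace Y] [CompactSpace Y]
    {F : Y → I → I → ℝ} (hF : Continuous fun z : (Y × I) × I => F z.1.1 z.1.2 z.2) {ε : ℝ}
    (hε : 0 < ε) :
    ∀ᶠ N : ℕ in atTop, ∀ y : Y,
      |((N : ℝ) ^ 2)⁻¹ * ∑ i : Fin N, ∑ j : Fin N, F y (site i) (site j)
        - ∫ u : I, ∫ v : I, F y u v| ≤ ε := by
  have hG : Continuous (Function.uncurry fun (y : Y) (u : I) => ∫ v : I, F y u v) := by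
    have := continuous_parametric_integral_of_continuous (μ := (volume : Measure I))
      (f := fun z : Y × I => F z.1 z.2) hF isCompact_univ
    simp only [Measure.restrict_univ] at this
    exact this
  filter_upwards [eventually_riemannSum (F := fun z : Y × I => F z.1 z.2) hF (half_pos hε),
    eventually_riemannSum hG (half_pos hε), eventually_gt_atTop 0] with N h1 h2 hN y
  have hN' : (0 : ℝ) < N := Nat.cast_pos.2 hN
  have e1 : |∑ i : Fin N, ((1 / (N : ℝ)) * ∑ j : Fin N, F y (site i) (site j)
      - ∫ v : I, F y (site i) v)| ≤ N * (ε / 2) := by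
    refine (Finset.abs_sum_le_sum_abs _ _).trans
      ((Finset.sum_le_card_nsmul _ _ _ fun i _ => h1 (y, site i)).trans_eq ?_)
    rw [Finset.card_univ, Fintype.card_fin, nsmul_eq_mul]
  have e2 := h2 y
  have e3 : ((N : ℝ) ^ 2)⁻¹ * ∑ i : Fin N, ∑ j : Fin N, F y (site i) (site j)
        - ∫ u : I, ∫ v : I, F y u v
      = (1 / (N : ℝ)) * ∑ i : Fin N, ((1 / (N : ℝ)) * ∑ j : Fin N, F y (site i) (site j)
          - ∫ v : I, F y (site i) v)
        + ((1 / (N : ℝ)) * ∑ i : Fin N, (∫ v : I, F y (site i) v) - ∫ u : I, ∫ v : I, F y u v) := by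
    rw [Finset.sum_sub_distrib, ← Finset.mul_sum]
    field_simp
    ring
  rw [e3]
  refine (abs_add_le _ _).trans ?_
  rw [abs_mul, abs_of_nonneg (by positivity : (0 : ℝ) ≤ 1 / N)]
  have e4 := mul_le_mul_of_nonneg_left e1 (by positivity : (0 : ℝ) ≤ 1 / N)
  have e5 : 1 / (N : ℝ) * (N * (ε / 2)) = ε / 2 := by field_simp
  linarith

theorem integral_pairEmpirical {N : ℕ} (x : Fin N → ℝ≥0) (f : I × I → ℝ) :
    ∫ z, f z ∂(pairEmpirical x)
      = ((N : ℝ) ^ 2)⁻¹ * ∑ i : Fin N, ∑ j : Fin N,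
        (x i : ℝ) * (x j : ℝ) * f (site i, site j) := by
  have hd : ∀ i j : Fin N,
      Integrable f ((x i * x j) • Measure.dirac ((site i, site j) : I × I)) := fun i j =>
    (integrable_dirac (by simp)).smul_measure_nnreal
  unfold pairEmpirical
  rw [integral_smul_nnreal_measure, integral_finsetSum_measure fun i _ =>
    integrable_finsetSum_measure.2 fun j _ => hd i j]
  simp_rw [integral_finsetSum_measure fun j _ => hd _ j, integral_smul_nnreal_measure,
    integral_dirac, NNReal.smul_def, smul_eq_mul]
  push_cast
  rfl

/-- The number of coincidences among four labels. -/
noncomputable def coincidences {N : ℕ} (q q' : Fin N × Fin N) : ℝ :=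
  (if q.1 = q.2 then 1 else 0) + (if q'.1 = q'.2 then 1 else 0) + (if q.1 = q'.1 then 1 else 0)
    + (if q.1 = q'.2 then 1 else 0) + (if q.2 = q'.1 then 1 else 0) + (if q.2 = q'.2 then 1 else 0)

/-- Each of the six possible equalities leaves three free labels. -/
theorem sum_coincidences (N : ℕ) :
    ∑ q : Fin N × Fin N, ∑ q' : Fin N × Fin N, coincidences q q' = 6 * (N : ℝ) ^ 3 := by
  simp only [coincidences, Fintype.sum_prod_type, Finset.sum_add_distrib]
  have h1 : ∑ _a : Fin N, ∑ _b : Fin N, ∑ c : Fin N, ∑ d : Fin N,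
    (if c = d then (1 : ℝ) else 0) = (N : ℝ) ^ 3 := by simp; ring
  have h2 : ∑ a : Fin N, ∑ b : Fin N, ∑ _c : Fin N, ∑ _d : Fin N,
    (if a = b then (1 : ℝ) else 0) = (N : ℝ) ^ 3 := by simp; ring
  have h3 : ∑ a : Fin N, ∑ _b : Fin N, ∑ c : Fin N, ∑ _d : Fin N,
    (if a = c then (1 : ℝ) else 0) = (N : ℝ) ^ 3 := by simp; ring
  have h4 : ∑ a : Fin N, ∑ _b : Fin N, ∑ _c : Fin N, ∑ d : Fin N,
    (if a = d then (1 : ℝ) else 0) = (N : ℝ) ^ 3 := by simp; ring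
  have h5 : ∑ _a : Fin N, ∑ b : Fin N, ∑ c : Fin N, ∑ _d : Fin N,
    (if b = c then (1 : ℝ) else 0) = (N : ℝ) ^ 3 := by simp; ring
  have h6 : ∑ _a : Fin N, ∑ b : Fin N, ∑ _c : Fin N, ∑ d : Fin N,
    (if b = d then (1 : ℝ) else 0) = (N : ℝ) ^ 3 := by simp; ring
  rw [h1, h2, h3, h4, h5, h6]
  ring

theorem coincidences_nonneg {N : ℕ} (q q' : Fin N × Fin N) : 0 ≤ coincidences q q' := by
  unfold coincidences
  positivity

/-- The centred product of the masses at a pair of urns. -/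
noncomputable def pairFluct (f : I → ℝ) {N : ℕ} (q : Fin N × Fin N) (x : Fin N → ℝ≥0) : ℝ :=
  (x q.1 : ℝ) * (x q.2 : ℝ) - f (site q.1) * f (site q.2)

section Fluctuations
variable {f : I → ℝ} {R : ℝ} {N : ℕ}

theorem abs_pairFluct_le (hf : ∀ u, |f u| ≤ R) (q : Fin N × Fin N) (x : Fin N → ℝ≥0) :
    |pairFluct f q x| ≤ (1 + R ^ 2) * (1 + ∑ k, (x k : ℝ)) ^ 2 := by
  have h1 := coe_le_one_add_sum x q.1
  have h2 := coe_le_one_add_sum x q.2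
  have hm : 1 ≤ 1 + ∑ k, (x k : ℝ) := le_add_of_nonneg_right (by positivity)
  have h3 : (x q.1 : ℝ) * x q.2 ≤ (1 + ∑ k, (x k : ℝ)) ^ 2 := by
    rw [sq]
    exact mul_le_mul h1 h2 (NNReal.coe_nonneg _) (by linarith)
  have h4 : |f (site q.1) * f (site q.2)| ≤ R ^ 2 := by
    rw [abs_mul, sq]
    exact mul_le_mul (hf _) (hf _) (abs_nonneg _) ((abs_nonneg _).trans (hf 0))
  have h5 : (1 : ℝ) ≤ (1 + ∑ k, (x k : ℝ)) ^ 2 := one_le_pow₀ hm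
  have h6 : (0 : ℝ) ≤ (x q.1 : ℝ) * x q.2 := by positivity
  unfold pairFluct
  refine (abs_sub _ _).trans ?_
  rw [abs_of_nonneg h6]
  nlinarith [sq_nonneg R]

/-- By `(ab - c)² ≤ 2a²b² + 2c² ≤ a⁴ + b⁴ + 2c²` and the arithmetic-geometric mean inequality.
Fourth moments thus suffice even when urns coincide. -/
theorem abs_pairFluct_mul_le (hf : ∀ u, |f u| ≤ R) (q q' : Fin N × Fin N) (x : Fin N → ℝ≥0) :
    |pairFluct f q x * pairFluct f q' x|
      ≤ (x q.1 : ℝ) ^ 4 + (x q.2 : ℝ) ^ 4 + (x q'.1 : ℝ) ^ 4 + (x q'.2 : ℝ) ^ 4 + 2 * R ^ 4 := by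
  have h : ∀ q : Fin N × Fin N,
      pairFluct f q x ^ 2 ≤ (x q.1 : ℝ) ^ 4 + (x q.2 : ℝ) ^ 4 + 2 * R ^ 4 := fun q => by
    have h4 : |f (site q.1) * f (site q.2)| ≤ R ^ 2 := by
      rw [abs_mul, sq]
      exact mul_le_mul (hf _) (hf _) (abs_nonneg _) ((abs_nonneg _).trans (hf 0))
    have h5 : (f (site q.1) * f (site q.2)) ^ 2 ≤ (R ^ 2) ^ 2 :=
      sq_le_sq.2 (h4.trans (le_abs_self _))
    unfold pairFluct
    nlinarith [sq_nonneg ((x q.1 : ℝ) * x q.2 + f (site q.1) * f (site q.2)),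
      sq_nonneg ((x q.1 : ℝ) ^ 2 - (x q.2 : ℝ) ^ 2)]
  rw [abs_mul]
  linarith [h q, h q', two_mul_le_add_sq |pairFluct f q x| |pairFluct f q' x|,
    sq_abs (pairFluct f q x), sq_abs (pairFluct f q' x),
    pow_nonneg (NNReal.coe_nonneg (x q.1)) 4, pow_nonneg (NNReal.coe_nonneg (x q.2)) 4,
    pow_nonneg (NNReal.coe_nonneg (x q'.1)) 4, pow_nonneg (NNReal.coe_nonneg (x q'.2)) 4]

variable {p : Coeffs} {K : ℝ} {φ : C(I, ℝ)} {Ω : Type*} [MeasurableSpace Ω] {P : Measure Ω}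
  [IsProbabilityMeasure P] {X : ℝ≥0 → Ω → (Fin N → ℝ≥0)}

theorem IsUrnLinearSystem.integrable_pairFluct_mul (hX : IsUrnLinearSystem p N P X)
    (hA : InitialAssumption φ N P (X 0)) (hK : p.IsBound K) (hf : ∀ u, |f u| ≤ R) (t : ℝ≥0)
    (q q' : Fin N × Fin N) :
    Integrable (fun ω => pairFluct f q (X t ω) * pairFluct f q' (X t ω)) P := by
  refine integrable_comp_of_le (f := fun x => pairFluct f q x * pairFluct f q' x)
    (W := massWeight) (K := (1 + R ^ 2) ^ 2) (by unfold pairFluct; fun_prop) (fun x => ?_)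
    (hX.measurable t) (hX.integrable_massWeight hA hK t)
  rw [abs_mul]
  refine (mul_le_mul (abs_pairFluct_le hf q x) (abs_pairFluct_le hf q' x) (abs_nonneg _)
    (by positivity)).trans_eq ?_
  unfold massWeight
  ring

/-- Two-point bound for the centred pair products: small for four distinct urns, bounded in
general. -/
theorem IsUrnLinearSystem.abs_integral_pairFluct_mul_le (hX : IsUrnLinearSystem p N P X)
    (hA : InitialAssumption φ N P (X 0)) (hK : p.IsBound K) (hf : ∀ u, |f u| ≤ R) {t : ℝ≥0}
    {ε M : ℝ} (hε : 0 ≤ ε) (hM : ∀ k, ∫ ω, (X t ω k : ℝ) ^ 4 ∂P ≤ M)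
    (h2 : ∀ s : Finset (Fin N), s.card = 2 →
      |∫ ω, ∏ k ∈ s, (X t ω k : ℝ) ∂P - ∏ k ∈ s, f (site k)| ≤ ε)
    (h4 : ∀ s : Finset (Fin N), s.card = 4 →
      |∫ ω, ∏ k ∈ s, (X t ω k : ℝ) ∂P - ∏ k ∈ s, f (site k)| ≤ ε)
    (q q' : Fin N × Fin N) :
    |∫ ω, pairFluct f q (X t ω) * pairFluct f q' (X t ω) ∂P|
      ≤ ε * (1 + 2 * R ^ 2) + (4 * M + 2 * R ^ 4) * coincidences q q' := by
  have hM0 : 0 ≤ M := (integral_nonneg fun ω => by positivity).trans (hM q.1)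
  have hc := coincidences_nonneg q q'
  -- For distinct urns the expectation equals `(E4 - A A') - A' (E2 - A) - A (E2' - A')`, which
  -- gives `ε (1 + 2R²)`. Otherwise `coincidences` is at least `1` and the fourth-moment bound
  -- applies.
  by_cases hd : q.1 ≠ q.2 ∧ q'.1 ≠ q'.2 ∧ q.1 ≠ q'.1 ∧ q.1 ≠ q'.2 ∧ q.2 ≠ q'.1 ∧ q.2 ≠ q'.2
  · obtain ⟨n1, n2, n3, n4, n5, n6⟩ := hd
    have hR2 : ∀ q : Fin N × Fin N, |f (site q.1) * f (site q.2)| ≤ R ^ 2 := fun q => by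
      rw [abs_mul, sq]
      exact mul_le_mul (hf _) (hf _) (abs_nonneg _) ((abs_nonneg _).trans (hf 0))
    have c4 : ({q.1, q.2, q'.1, q'.2} : Finset (Fin N)).card = 4 := by
      rw [Finset.card_insert_of_notMem (by simp [n1, n3, n4]),
        Finset.card_insert_of_notMem (by simp [n5, n6]), Finset.card_pair n2]
    have p4 : ∀ y : Fin N → ℝ, ∏ k ∈ ({q.1, q.2, q'.1, q'.2} : Finset (Fin N)), y k
        = (y q.1 * y q.2) * (y q'.1 * y q'.2) := fun y => by
      rw [Finset.prod_insert (by simp [n1, n3, n4]), Finset.prod_insert (by simp [n5, n6]),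
        Finset.prod_pair n2, mul_assoc]
    have i4 := hX.integrable_monomial hA hK c4.le t
    have i2 := hX.integrable_monomial hA hK
      (((Finset.card_pair n1).trans_le (by norm_num) : _ ≤ 4)) t
    have i2' := hX.integrable_monomial hA hK
      (((Finset.card_pair n2).trans_le (by norm_num) : _ ≤ 4)) t
    have b4 := h4 _ c4
    have b2 := h2 _ (Finset.card_pair n1)
    have b2' := h2 _ (Finset.card_pair n2)
    simp only [p4 (fun k => (X t _ k : ℝ)), p4 (fun k => f (site k)), Finset.prod_pair n1,
      Finset.prod_pair n2] at i4 i2 i2' b4 b2 b2'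
    set A := f (site q.1) * f (site q.2)
    set A' := f (site q'.1) * f (site q'.2)
    have hexp : ∀ ω, pairFluct f q (X t ω) * pairFluct f q' (X t ω)
        = ((X t ω q.1 : ℝ) * X t ω q.2 * (X t ω q'.1 * X t ω q'.2)
          - A' * ((X t ω q.1 : ℝ) * X t ω q.2)) - A * ((X t ω q'.1 : ℝ) * X t ω q'.2)
          + A * A' := fun ω => by
      simp only [pairFluct, A, A']
      ring
    have j1 : Integrable (fun ω => (X t ω q.1 : ℝ) * X t ω q.2 * (X t ω q'.1 * X t ω q'.2)
          - A' * ((X t ω q.1 : ℝ) * X t ω q.2)) P := i4.sub (i2.const_mul A')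
    have j2 : Integrable (fun ω => (X t ω q.1 : ℝ) * X t ω q.2 * (X t ω q'.1 * X t ω q'.2)
          - A' * ((X t ω q.1 : ℝ) * X t ω q.2) - A * ((X t ω q'.1 : ℝ) * X t ω q'.2)) P :=
      j1.sub (i2'.const_mul A)
    simp_rw [hexp]
    rw [integral_add j2 (integrable_const _), integral_sub j1 (i2'.const_mul A),
      integral_sub i4 (i2.const_mul A'), integral_const_mul, integral_const_mul, integral_const,
      probReal_univ, one_smul]
    set E4 := ∫ ω, (X t ω q.1 : ℝ) * X t ω q.2 * (X t ω q'.1 * X t ω q'.2) ∂P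
    set E2 := ∫ ω, (X t ω q.1 : ℝ) * X t ω q.2 ∂P
    set E2' := ∫ ω, (X t ω q'.1 : ℝ) * X t ω q'.2 ∂P
    have k1 : |A' * (E2 - A)| ≤ R ^ 2 * ε := by
      rw [abs_mul]
      exact mul_le_mul (hR2 q') b2 (abs_nonneg _) (sq_nonneg R)
    have k2 : |A * (E2' - A')| ≤ R ^ 2 * ε := by
      rw [abs_mul]
      exact mul_le_mul (hR2 q) b2' (abs_nonneg _) (sq_nonneg R)
    have k3 : 0 ≤ (4 * M + 2 * R ^ 4) * coincidences q q' := mul_nonneg (by positivity) hc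
    rw [abs_le] at k1 k2 b4 ⊢
    constructor <;> linarith
  · have hc1 : 1 ≤ coincidences q q' := by
      unfold coincidences
      by_contra h
      apply hd
      have h0 : ∀ c : Prop, [Decidable c] → (0 : ℝ) ≤ if c then 1 else 0 := fun c _ => by
        split_ifs <;> norm_num
      refine ⟨?_, ?_, ?_, ?_, ?_, ?_⟩ <;> intro hh <;> apply h <;> rw [if_pos hh] <;>
        linarith [h0 (q.1 = q.2), h0 (q'.1 = q'.2), h0 (q.1 = q'.1), h0 (q.1 = q'.2),
          h0 (q.2 = q'.1), h0 (q.2 = q'.2)]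
    have hi := fun k => (hX.fourth_moment hA hK k t).1
    have j2 : Integrable (fun ω => (X t ω q.1 : ℝ) ^ 4 + (X t ω q.2 : ℝ) ^ 4) P :=
      (hi _).add (hi _)
    have j3 : Integrable (fun ω => (X t ω q.1 : ℝ) ^ 4 + (X t ω q.2 : ℝ) ^ 4
      + (X t ω q'.1 : ℝ) ^ 4) P := j2.add (hi _)
    have j4 : Integrable (fun ω => (X t ω q.1 : ℝ) ^ 4 + (X t ω q.2 : ℝ) ^ 4
      + (X t ω q'.1 : ℝ) ^ 4 + (X t ω q'.2 : ℝ) ^ 4) P := j3.add (hi _)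
    have j5 : Integrable (fun ω => (X t ω q.1 : ℝ) ^ 4 + (X t ω q.2 : ℝ) ^ 4
      + (X t ω q'.1 : ℝ) ^ 4 + (X t ω q'.2 : ℝ) ^ 4 + 2 * R ^ 4) P :=
      j4.add (integrable_const _)
    have h1 := norm_integral_le_of_norm_le
      (f := fun ω => pairFluct f q (X t ω) * pairFluct f q' (X t ω)) j5
      (ae_of_all _ fun ω => abs_pairFluct_mul_le hf q q' (X t ω))
    rw [integral_add j4 (integrable_const _), integral_add j3 (hi _), integral_add j2 (hi _),
      integral_add (hi _) (hi _), integral_const, probReal_univ, one_smul,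
      Real.norm_eq_abs] at h1
    have h3 : 0 ≤ ε * (1 + 2 * R ^ 2) := by positivity
    have h5 : 0 ≤ 4 * M + 2 * R ^ 4 := by positivity
    nlinarith [hM q.1, hM q.2, hM q'.1, hM q'.2]

/-- Variance bound for weighted sums of centred pair products. -/
theorem IsUrnLinearSystem.integral_sq_sum_pairFluct_le (hX : IsUrnLinearSystem p N P X)
    (hA : InitialAssumption φ N P (X 0)) (hK : p.IsBound K) (hf : ∀ u, |f u| ≤ R) {t : ℝ≥0}
    {δ M B : ℝ}
    (hM : ∀ q q' : Fin N × Fin N, |∫ ω, pairFluct f q (X t ω) * pairFluct f q' (X t ω) ∂P|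
      ≤ δ + M * coincidences q q')
    (hN : 0 < N) {h : Fin N × Fin N → ℝ} (hB : ∀ q, |h q| ≤ B) :
    Integrable (fun ω => (((N : ℝ) ^ 2)⁻¹ * ∑ q, h q * pairFluct f q (X t ω)) ^ 2) P ∧
    ∫ ω, (((N : ℝ) ^ 2)⁻¹ * ∑ q, h q * pairFluct f q (X t ω)) ^ 2 ∂P
      ≤ B ^ 2 * (δ + 6 * M * (1 / (N : ℝ))) := by
  have hN' : (0 : ℝ) < N := Nat.cast_pos.2 hN
  have hsq : ∀ ω, (((N : ℝ) ^ 2)⁻¹ * ∑ q, h q * pairFluct f q (X t ω)) ^ 2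
      = ((N : ℝ) ^ 4)⁻¹ * ∑ q, ∑ q', (h q * h q') *
        (pairFluct f q (X t ω) * pairFluct f q' (X t ω)) := fun ω => by
    rw [mul_pow, sq (∑ q, _), Finset.sum_mul_sum]
    congr 1
    · rw [inv_pow, ← pow_mul]
    · refine Finset.sum_congr rfl fun q _ => Finset.sum_congr rfl fun q' _ => ?_
      ring
  have hi : ∀ q q', Integrable (fun ω => (h q * h q') *
        (pairFluct f q (X t ω) * pairFluct f q' (X t ω))) P := fun q q' =>
    (hX.integrable_pairFluct_mul hA hK hf t q q').const_mul _
  have hi2 : ∀ q, Integrable (fun ω => ∑ q', (h q * h q') *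
        (pairFluct f q (X t ω) * pairFluct f q' (X t ω))) P := fun q =>
    integrable_finsetSum _ fun q' _ => hi q q'
  simp_rw [hsq]
  refine ⟨(integrable_finsetSum _ fun q _ => hi2 q).const_mul _, ?_⟩
  rw [integral_const_mul, integral_finsetSum _ fun q _ => hi2 q]
  simp_rw [integral_finsetSum _ fun q' _ => hi _ q', integral_const_mul]
  have hterm : ∀ q q', h q * h q' * ∫ ω, pairFluct f q (X t ω) * pairFluct f q' (X t ω) ∂P
      ≤ B ^ 2 * (δ + M * coincidences q q') := fun q q' => by
    refine (le_abs_self _).trans ?_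
    rw [abs_mul, abs_mul, sq]
    have hB0 : 0 ≤ B := (abs_nonneg _).trans (hB q)
    exact mul_le_mul (mul_le_mul (hB q) (hB q') (abs_nonneg _) hB0) (hM q q') (abs_nonneg _)
      (mul_nonneg hB0 hB0)
  calc _ ≤ ((N : ℝ) ^ 4)⁻¹ * ∑ q : Fin N × Fin N, ∑ q' : Fin N × Fin N,
        B ^ 2 * (δ + M * coincidences q q') :=
        mul_le_mul_of_nonneg_left (Finset.sum_le_sum fun q _ => Finset.sum_le_sum fun q' _ =>
          hterm q q') (by positivity)
    -- The term `δ` is summed over `N⁴` quadruples, the coincidences only amount to `6N³`.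
    _ = B ^ 2 * (δ + 6 * M * (1 / (N : ℝ))) := by
        simp_rw [← Finset.mul_sum, Finset.sum_add_distrib, ← Finset.mul_sum, sum_coincidences]
        simp only [Finset.sum_const, Finset.card_univ, Fintype.card_prod, Fintype.card_fin,
          nsmul_eq_mul]
        push_cast
        field_simp

end Fluctuations
end UrnSystem

/-- With a lower Lebesgue integral and a supremum in `ℝ≥0∞`, neither non-integrability nor
unboundedness can hide behind a default value. -/
theorem lemma2p4 (p : UrnSystem.Coeffs) (φ : C(I, ℝ))
    {Ω : ℕ → Type*} [∀ N, MeasurableSpace (Ω N)]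
    (P : ∀ N, Measure (Ω N)) [∀ N, IsProbabilityMeasure (P N)]
    (X : ∀ N, ℝ≥0 → Ω N → (Fin N → ℝ≥0))
    (hX : ∀ N, UrnSystem.IsUrnLinearSystem p N (P N) (X N))
    (hA : ∀ N, UrnSystem.InitialAssumption φ N (P N) (X N 0))
    (ρ : ℝ → C(I, ℝ)) (hρ : UrnSystem.IsHydrodynamicDensity p φ ρ)
    (T : ℝ≥0) (hT : 0 < T) (H : C(Set.Icc (0 : ℝ≥0) T × I × I, ℝ)) :
    Tendsto
      (fun N : ℕ => ⨆ t : Set.Icc (0 : ℝ≥0) T,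
        ∫⁻ ω, ENNReal.ofReal
          (((∫ z, H (t, z) ∂(UrnSystem.pairEmpirical (X N t ω))) -
            ∫ u : I, ∫ v : I, ρ ((t : ℝ≥0) : ℝ) u * ρ ((t : ℝ≥0) : ℝ) v * H (t, u, v)) ^ 2) ∂(P N))
      atTop (𝓝 0) := by
  obtain ⟨K, hK⟩ := p.exists_isBound
  obtain ⟨R, hR, hρR⟩ := hρ.exists_bound T
  have hK1 := hK.one_le
  set B := ‖H‖
  have hB : ∀ z, |H z| ≤ B := H.norm_coe_le_norm
  set M₀ := Real.exp (51 * K ^ 5 * T) * 2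
  have hM₀ : 0 < M₀ := by positivity
  set M := 4 * M₀ + 2 * R ^ 4
  have hcont : Continuous fun z : (Set.Icc (0 : ℝ≥0) T × I) × I =>
      ρ (z.1.1 : ℝ≥0) z.1.2 * ρ (z.1.1 : ℝ≥0) z.2 * H (z.1.1, z.1.2, z.2) := by
    have h1 : Continuous fun z : (Set.Icc (0 : ℝ≥0) T × I) × I => ρ (z.1.1 : ℝ≥0) :=
      hρ.continuous.comp (by fun_prop)
    exact ((h1.eval (by fun_prop)).mul (h1.eval (by fun_prop))).mul (by fun_prop)
  -- The error is split as `Z + d`, with `Z` the random fluctuation and `d` the deterministic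
  -- Riemann-sum error, and `(Z + d)² ≤ 2Z² + 2d²`. The restriction `δ ≤ 1` turns `|d| ≤ δ` into `d²
  -- ≤ δ`.
  have hkey : ∀ δ : ℝ, 0 < δ → δ ≤ 1 → ∀ᶠ N : ℕ in atTop, ∀ t : Set.Icc (0 : ℝ≥0) T,
      ∫⁻ ω, ENNReal.ofReal (((∫ z, H (t, z) ∂(UrnSystem.pairEmpirical (X N t ω))) -
        ∫ u : I, ∫ v : I, ρ ((t : ℝ≥0) : ℝ) u * ρ ((t : ℝ≥0) : ℝ) v * H (t, u, v)) ^ 2) ∂(P N)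
        ≤ ENNReal.ofReal (2 * (B ^ 2 * (δ * (1 + 2 * R ^ 2) + 6 * M * δ)) + 2 * δ) := by
    intro δ hδ hδ1
    filter_upwards [
      UrnSystem.eventually_abs_correlation_sub_le hX hA hρ T (n := 2) (by norm_num) hδ,
      UrnSystem.eventually_abs_correlation_sub_le hX hA hρ T (n := 4) le_rfl hδ,
      UrnSystem.eventually_double_riemannSum (F := fun (t : Set.Icc (0 : ℝ≥0) T) u v =>
        ρ (t : ℝ≥0) u * ρ (t : ℝ≥0) v * H (t, u, v)) hcont hδ,
      (tendsto_one_div_atTop_nhds_zero_nat (𝕜 := ℝ)).eventually (gt_mem_nhds hδ),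
      eventually_gt_atTop 0] with N h2 h4 hr hNδ hN t
    have hf : ∀ u, |ρ (t : ℝ≥0) u| ≤ R := hρR t t.2.2
    have hm : ∀ k, ∫ ω, (X N t ω k : ℝ) ^ 4 ∂(P N) ≤ M₀ := fun k => by
      refine ((hX N).fourth_moment (hA N) hK k t).2.trans ?_
      have : ((t : ℝ≥0) : ℝ) ≤ T := NNReal.coe_le_coe.2 t.2.2
      simp only [M₀]
      gcongr
    obtain ⟨hi, hb⟩ := (hX N).integral_sq_sum_pairFluct_le (hA N) hK hf
      ((hX N).abs_integral_pairFluct_mul_le (hA N) hK hf hδ.le hm (h2 t t.2.2) (h4 t t.2.2)) hN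
      (h := fun q => H (t, UrnSystem.site q.1, UrnSystem.site q.2)) fun q => hB _
    set Z : Ω N → ℝ := fun ω => ((N : ℝ) ^ 2)⁻¹ * ∑ q : Fin N × Fin N,
      H (t, UrnSystem.site q.1, UrnSystem.site q.2)
        * UrnSystem.pairFluct (fun u => ρ (t : ℝ≥0) u) q (X N t ω) with hZ
    set J := ∫ u : I, ∫ v : I, ρ ((t : ℝ≥0) : ℝ) u * ρ ((t : ℝ≥0) : ℝ) v * H (t, u, v)
    set d := ((N : ℝ) ^ 2)⁻¹ * ∑ i : Fin N, ∑ j : Fin N, ρ (t : ℝ≥0) (UrnSystem.site i)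
      * ρ (t : ℝ≥0) (UrnSystem.site j) * H (t, UrnSystem.site i, UrnSystem.site j) - J with hd
    have hdδ : |d| ≤ δ := hr t
    have hd2 : d ^ 2 ≤ δ := by
      rw [← sq_abs]
      nlinarith [abs_nonneg d]
    have hdecomp : ∀ ω, (∫ z, H (t, z) ∂(UrnSystem.pairEmpirical (X N t ω))) - J = Z ω + d :=
      fun ω => by
        rw [UrnSystem.integral_pairEmpirical, hZ, hd]
        simp only [UrnSystem.pairFluct, Fintype.sum_prod_type]
        rw [← add_sub_assoc, ← mul_add, ← Finset.sum_add_distrib]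
        congr 2
        refine Finset.sum_congr rfl fun i _ => ?_
        rw [← Finset.sum_add_distrib]
        refine Finset.sum_congr rfl fun j _ => ?_
        ring
    have hint : Integrable (fun ω => 2 * Z ω ^ 2 + 2 * δ) (P N) :=
      (hi.const_mul 2).add (integrable_const _)
    calc _ ≤ ∫⁻ ω, ENNReal.ofReal (2 * Z ω ^ 2 + 2 * δ) ∂(P N) := by
          refine lintegral_mono fun ω => ENNReal.ofReal_le_ofReal ?_
          rw [hdecomp]
          nlinarith [sq_nonneg (Z ω - d)]
      _ = ENNReal.ofReal (∫ ω, (2 * Z ω ^ 2 + 2 * δ) ∂(P N)) :=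
          (ofReal_integral_eq_lintegral_ofReal hint (ae_of_all _ fun ω => by positivity)).symm
      _ ≤ _ := by
          refine ENNReal.ofReal_le_ofReal ?_
          rw [integral_add (hi.const_mul 2) (integrable_const _), integral_const_mul,
            integral_const, probReal_univ, one_smul]
          have hM : 0 ≤ M := by positivity
          have h6 : B ^ 2 * (δ * (1 + 2 * R ^ 2) + 6 * M * (1 / (N : ℝ)))
              ≤ B ^ 2 * (δ * (1 + 2 * R ^ 2) + 6 * M * δ) := by gcongr
          linarith
  have hlim : Tendsto (fun δ : ℝ => ENNReal.ofReal
      (2 * (B ^ 2 * (δ * (1 + 2 * R ^ 2) + 6 * M * δ)) + 2 * δ)) (𝓝[>] 0) (𝓝 0) := by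
    have : Continuous fun δ : ℝ => ENNReal.ofReal
      (2 * (B ^ 2 * (δ * (1 + 2 * R ^ 2) + 6 * M * δ)) + 2 * δ) :=
      ENNReal.continuous_ofReal.comp (by fun_prop)
    simpa using (this.tendsto 0).mono_left nhdsWithin_le_nhds
  rw [ENNReal.tendsto_nhds_zero]
  intro ε hε
  -- The bound in `hkey` tends to `0` with `δ`, so some `δ` in `(0, 1]` brings it below `ε`.
  obtain ⟨δ, hδε, hδ⟩ := ((hlim.eventually (ge_mem_nhds hε)).and
    (Ioc_mem_nhdsGT zero_lt_one)).exists
  filter_upwards [hkey δ hδ.1 hδ.2] with N hN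
  exact (iSup_le hN).trans hδε
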